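/- Let $d\ge 1$, let $\mathbf T^d=[-\pi,\pi]^d/\!\sim$ be the torus with Lebesgue measure, and let $|x|$ be the Euclidean torus distance from $x$ to $0$. Let $\mathfrak T\subseteq(-d,\infty)$ be a set of types that is bounded above and satisfies $\inf\mathfrak T>-d$. For $\mathfrak t\in\mathfrak T$ and $\varepsilon\in(0,1)$ let $K_{\mathfrak t,\varepsilon}:\mathbf T^d\to\mathbf R$ be measurable kernels with $$\sup_{\mathfrak t\in\mathfrak T}\ \sup_{\varepsilon\in(0,1)}\ \sup_{x\in\mathbf T^d}(|x|+\varepsilon)^{-\mathfrak t}\,|K_{\mathfrak t,\varepsilon}(x)|<\infty .$$ (If $\mathfrak T$ is finite, these uniformity conditions say just that $\mathfrak T\subseteq(-d,\infty)$ and that the bound holds for each type.) A typed Feynman diagram $\Gamma=(V,E,\mathfrak t)$ is a finite directed multigraph with a set $L\subseteq V$ of leaves and a map $\mathfrak t:E\to\mathfrak T$; an edge $e$ runs from $e_-$ to $e_+$. Put $V_\star=V\setminus L$, let $E_\star$ be the set of edges with both endpoints in $V_\star$, and $E_L=E\setminus E_\star$. It is a $2k$-Feynman diagram if $|L|=2k$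 and every leaf lies on exactly one edge (has graph degree one). For $\varphi\in C^\infty((\mathbf T^d)^L;\mathbf R)$ set $$\Pi_\varepsilon\Gamma(\varphi)=\int_{(\mathbf T^d)^L}\Big(\int_{(\mathbf T^d)^{V_\star}}\prod_{e\in E_\star}K_{\mathfrak t(e),\varepsilon}(x_{e_+}-x_{e_-})\prod_{e\in E_L}K_{\mathfrak t(e),\varepsilon}(x_{e_+}-x_{e_-})\,\mathrm dx_{V_\star}\Big)\varphi(x_L)\,\mathrm dx_L .$$ A subdiagram consists of a set $\overline V\subseteq V_\star$ and a set $\overline E\subseteq E_\star$ of edges with endpoints in $\overline V$; its degree is the sum, over its connected components $(V',E')$, of $d(|V'|-1)+\sum_{e\in E'}\mathfrak t(e)$. $\Gamma$ is non-negative if all its subdiagrams have degree $\ge 0$. Let $\mathcal T_{V_\star}$ be the set of Hepp trees over $V_\star$: rooted binary trees with leaf set $V_\star$ (every inner node has two unordered children). For an inner node $u$ of $T\in\mathcal T_{V_\star}$ let $V_u\subseteq V_\star$ be the set of leaves of $T$ below $u$, let $E_u$ be the set of edges of $\Gamma$ with both endpoints in $V_u$, let $\overline{\deg}(u)=d(|V_u|-1)+\sum_{e\in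 E_u}\mathfrak t(e)$, and let $\mathrm{Null}(T)$ be the number of inner nodes $u$ with $\overline{\deg}(u)=0$. Then there exists a constant $C>0$ such that for all $k\ge 0$, every non-negative $2k$-Feynman diagram $\Gamma$ with $V_\star\neq\emptyset$ and with $\mathfrak t(e)\in\mathbf Z$ for all $e\in E_\star$, every $\varepsilon\in(0,1)$ and every $\varphi\in C^\infty((\mathbf T^d)^L;\mathbf R)$, $$|\Pi_\varepsilon\Gamma(\varphi)|\le\|\varphi\|_\infty\,C^{|V_\star|+|E_\star|+2k}\sum_{T\in\mathcal T_{V_\star}}\Big(\max\big\{1,\log\tfrac1\varepsilon\big\}\Big)^{\mathrm{Null}(T)} .$$ -/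

import Mathlib

noncomputable section

namespace Feynman

/-- The `d`-dimensional torus `[-π, π]^d / ∼`; its `volume` is Lebesgue measure, of total
mass `(2π)^d`. -/
abbrev Torus (d : ℕ) : Type := Fin d → AddCircle (2 * Real.pi)

instance : Fact ((0 : ℝ) < 2 * Real.pi) := ⟨Real.two_pi_pos⟩

/-- `|x|`: the (Euclidean) distance on the torus between `x` and `0`. -/
def torusNorm {d : ℕ} (x : Torus d) : ℝ := Real.sqrt (∑ i, ‖x i‖ ^ 2)

/-- Smooth functions on `(𝐓^d)^I`: those whose periodic lift to `(ℝ^d)^I` is smooth. -/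
def IsSmooth {d : ℕ} {I : Type*} [Fintype I] (φ : (I → Torus d) → ℝ) : Prop :=
  ContDiff ℝ ((⊤ : ℕ∞) : WithTop ℕ∞)
    (fun y : I → Fin d → ℝ => φ (fun l i => (y l i : AddCircle (2 * Real.pi))))

/-- The supremum norm. -/
def supNorm {X : Type*} (φ : X → ℝ) : ℝ := ⨆ x, |φ x|

/-- A typed Feynman diagram: a directed multigraph with vertices `V` and edges `E` (so parallel
edges and self-loops are possible), each edge `e = (e₋, e₊)` running from `src e = e₋` to
`tgt e = e₊`, with a distinguished set of leaves and with a type from `𝔗` on each edge. -/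
structure Diagram (𝔗 : Set ℝ) (V E : Type*) where
  src : E → V
  tgt : E → V
  leaves : Finset V
  type : E → 𝔗

namespace Diagram

variable {𝔗 : Set ℝ} {V E : Type*} [Fintype V] [Fintype E] (Γ : Diagram 𝔗 V E)

open Classical in
/-- The inner vertices `V⋆ = V \ L`. -/
def inner : Finset V := Finset.univ.filter (fun v => v ∉ Γ.leaves)

open Classical in
/-- The inner edges `E⋆`, with both endpoints in `V⋆`. -/
def innerEdges : Finset E :=
  Finset.univ.filter (fun e => Γ.src e ∈ Γ.inner ∧ Γ.tgt e ∈ Γ.inner)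

open Classical in
/-- The legs `E_L = E \ E⋆`. -/
def legs : Finset E := Finset.univ.filter (fun e => e ∉ Γ.innerEdges)

open Classical in
/-- Graph degree of a vertex: number of outgoing plus number of incoming edges. -/
def vertexDegree (v : V) : ℕ :=
  (Finset.univ.filter (fun e => Γ.src e = v)).card +
    (Finset.univ.filter (fun e => Γ.tgt e = v)).card

/-- A diagram with `2k` legs: it has `2k` leaves and each leaf lies on exactly one edge. -/
def HasLegs (k : ℕ) : Prop :=
  Γ.leaves.card = 2 * k ∧ ∀ v ∈ Γ.leaves, Γ.vertexDegree v = 1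

/-! ### Degrees -/

/-- A subdiagram: some inner vertices together with some of the edges between them. -/
structure Subdiagram where
  verts : Finset V
  edges : Finset E
  verts_subset : verts ⊆ Γ.inner
  src_mem : ∀ e ∈ edges, Γ.src e ∈ verts
  tgt_mem : ∀ e ∈ edges, Γ.tgt e ∈ verts

variable {Γ} in
/-- The undirected simple graph on `V` underlying a subdiagram. -/
def Subdiagram.graph (S : Γ.Subdiagram) : SimpleGraph V :=
  SimpleGraph.fromRel (fun v w => ∃ e ∈ S.edges, Γ.src e = v ∧ Γ.tgt e = w)

open Classical in
variable {Γ} in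
/-- The degree of a subdiagram in dimension `d`: the sum, over its connected components, of
`d (number of vertices - 1) + sum of the types of the edges`. -/
def Subdiagram.deg (d : ℕ) (S : Γ.Subdiagram) : ℝ :=
  ∑ c ∈ S.verts.image S.graph.connectedComponentMk,
    ((d : ℝ) * (((S.verts.filter (fun v => S.graph.connectedComponentMk v = c)).card : ℝ) - 1) +
      ∑ e ∈ S.edges.filter (fun e => S.graph.connectedComponentMk (Γ.src e) = c),
        (Γ.type e : ℝ))

/-- All subdiagrams have non-negative degree. -/
def NonNegative (d : ℕ) : Prop := ∀ S : Γ.Subdiagram, 0 ≤ S.deg d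

/-! ### The valuation -/

open Classical in
/-- The configuration on `V` with prescribed values at the leaves and at the inner vertices. -/
def glue {X : Type*} (xL : {v // v ∈ Γ.leaves} → X) (xI : {v // v ∉ Γ.leaves} → X) : V → X :=
  fun v => if h : v ∈ Γ.leaves then xL ⟨v, h⟩ else xI ⟨v, h⟩

/-- `∏ K_{𝔱(e), ε}(x_{e₊} - x_{e₋})` over the edges `e ∈ S`. -/
def weight {d : ℕ} (K : 𝔗 → ℝ → Torus d → ℝ) (ε : ℝ) (S : Finset E) (x : V → Torus d) : ℝ :=
  ∏ e ∈ S, K (Γ.type e) ε (x (Γ.tgt e) - x (Γ.src e))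

open Classical in
/-- `Π_ε Γ (x_L)`: integrate the product of all kernels over the inner variables. -/
def val {d : ℕ} (K : 𝔗 → ℝ → Torus d → ℝ) (ε : ℝ)
    (xL : {v // v ∈ Γ.leaves} → Torus d) : ℝ :=
  ∫ xI : {v // v ∉ Γ.leaves} → Torus d,
    Γ.weight K ε Γ.innerEdges (Γ.glue xL xI) * Γ.weight K ε Γ.legs (Γ.glue xL xI)

/-- `Π_ε Γ (φ)`: test the valuation against a function of the leaf variables. -/
def valTest {d : ℕ} (K : 𝔗 → ℝ → Torus d → ℝ) (ε : ℝ)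
    (φ : ({v // v ∈ Γ.leaves} → Torus d) → ℝ) : ℝ :=
  ∫ xL : {v // v ∈ Γ.leaves} → Torus d, Γ.val K ε xL * φ xL

end Diagram

/-! ### Hepp trees -/

/-- Finite rooted (planar) binary trees with leaves labelled by `V`. -/
inductive BinTree (V : Type*) where
  | leaf (v : V) : BinTree V
  | graft (T₁ T₂ : BinTree V) : BinTree V

namespace BinTree

variable {V : Type*}

/-- The multiset of labels of the leaves. -/
def labels : BinTree V → Multiset V
  | leaf v => {v}
  | graft T₁ T₂ => T₁.labels + T₂.labels

open Classical in
/-- For every inner node, the set of leaves below it. -/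
def clusters : BinTree V → Finset (Finset V)
  | leaf _ => ∅
  | graft T₁ T₂ => insert (T₁.labels + T₂.labels).toFinset (T₁.clusters ∪ T₂.clusters)

end BinTree

open Classical in
/-- The Hepp trees over `X`: rooted binary trees whose leaves are in bijection with `X`, the two
children of a node being unordered. Such a tree is recorded by the sets of leaves below its inner
nodes: distinct inner nodes have distinct sets of leaves below them, and two planar trees with
leaves in bijection with `X` have the same family of such sets if and only if they differ by the
order of children only. An element `T` of `heppTrees X` is thus the set of inner nodes of a tree,
and `u ∈ T` is the set of leaves that are descendants of the node. -/
def heppTrees {V : Type*} (X : Finset V) : Finset (Finset (Finset V)) :=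
  X.powerset.powerset.filter (fun F => ∃ T : BinTree V, T.labels = X.val ∧ T.clusters = F)

namespace Diagram

variable {𝔗 : Set ℝ} {V E : Type*} [Fintype V] [Fintype E] (Γ : Diagram 𝔗 V E)

open Classical in
/-- `d (|V⋆(Γ_u)| - 1) + ∑ 𝔱(e)` over the edges `e` of the full subdiagram `Γ_u` spanned by the
set `u` of inner vertices. -/
def degBar (d : ℕ) (u : Finset V) : ℝ :=
  (d : ℝ) * ((u.card : ℝ) - 1) +
    ∑ e ∈ Finset.univ.filter (fun e => Γ.src e ∈ u ∧ Γ.tgt e ∈ u), (Γ.type e : ℝ)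

open Classical in
/-- The number of inner nodes `u` of the Hepp tree `T` for which `degBar u = 0`. -/
def null (d : ℕ) (T : Finset (Finset V)) : ℕ :=
  (T.filter (fun u => Γ.degBar d u = 0)).card

end Diagram

end Feynman

end

/-!
Bound the integrand by its absolute value, and round every distance `|x_{e₊} - x_{e₋}|` to a dyadic
scale between `1` and `ε`. Joining the inner vertices greedily along the shortest edges
(single-linkage clustering) assigns to each configuration a Hepp tree whose nodes carry scales that
increase away from the root, and the integrand is at most a majorant depending on this tree only.
By translation invariance the majorant can be integrated node by node, from the leaves to the root,
and a node `u` contributes a geometric series `∑ₘ 2 ^ (-m * excess u)`. The excess is a non-negative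
integer: where it is positive, the series is bounded, and where it vanishes, so does `degBar u`, and
the at most `N + 1 ≲ log (1 / ε)` scales between `1` and `ε` contribute one power of the logarithm.

An edge of positive type makes its kernel small on small clusters. Only one such factor is used for
each minimal cluster containing an edge of positive type: since types are integers, this turns
`degBar u > 0` into positive excess, and the diameter bounds `4 * |u|` of these disjoint clusters
multiply to at most `8 ^ |V⋆|`.
-/

noncomputable section

namespace Feynman

open MeasureTheory
open scoped Classical ENNReal

namespace BinTree

variable {V : Type*}

/-- Equality of planar binary trees up to the order of children: the equivalence whose classes
are the Hepp trees. -/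
inductive SwapEquiv : BinTree V → BinTree V → Prop
  | leaf (v : V) : SwapEquiv (leaf v) (leaf v)
  | congr {A₁ A₂ B₁ B₂ : BinTree V} : SwapEquiv A₁ A₂ → SwapEquiv B₁ B₂ →
      SwapEquiv (graft A₁ B₁) (graft A₂ B₂)
  | swap {A₁ A₂ B₁ B₂ : BinTree V} : SwapEquiv A₁ B₂ → SwapEquiv B₁ A₂ →
      SwapEquiv (graft A₁ B₁) (graft A₂ B₂)

/-- The set of leaf labels, that is, the cluster of the root. -/
def support (T : BinTree V) : Finset V := T.labels.toFinset

@[simp] theorem mem_support {T : BinTree V} {v : V} : v ∈ T.support ↔ v ∈ T.labels := by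
  simp [support]

@[simp] theorem support_leaf (v : V) : (leaf v).support = {v} := by
  simp [support, labels]

theorem support_graft (A B : BinTree V) : (graft A B).support = A.support ∪ B.support := by
  simp [support, labels]

theorem support_graft_comm (A B : BinTree V) : (graft A B).support = (graft B A).support := by
  rw [support_graft, support_graft, Finset.union_comm]

theorem support_eq_of_labels_eq {T : BinTree V} {X : Finset V} (h : T.labels = X.val) :
    T.support = X := by
  ext v
  rw [mem_support, h, Finset.mem_val]

theorem SwapEquiv.support_eq {T T' : BinTree V} (h : SwapEquiv T T') :
    T.support = T'.support := by
  induction h with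
  | leaf v => rfl
  | congr _ _ h1 h2 => rw [support_graft, support_graft, h1, h2]
  | swap _ _ h1 h2 => rw [support_graft_comm, support_graft, support_graft, h1, h2]

theorem support_nonempty (T : BinTree V) : T.support.Nonempty := by
  induction T with
  | leaf v => simp
  | graft A B hA _ => exact support_graft A B ▸ hA.inl

theorem mem_sum_labels {𝓕 : Multiset (BinTree V)} {v : V} :
    v ∈ (𝓕.map labels).sum ↔ ∃ T ∈ 𝓕, v ∈ T.support := by
  induction 𝓕 using Multiset.induction_on with
  | empty => simp
  | cons T 𝓕 ih => simp [ih]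

theorem nodup_graft {A B : BinTree V} :
    (graft A B).labels.Nodup ↔
      A.labels.Nodup ∧ B.labels.Nodup ∧ Disjoint A.support B.support := by
  simp only [labels, Multiset.nodup_add, Finset.disjoint_left, Multiset.disjoint_left, mem_support]

theorem clusters_graft (A B : BinTree V) :
    (graft A B).clusters = insert (graft A B).support (A.clusters ∪ B.clusters) := rfl

theorem clusters_graft_comm (A B : BinTree V) : (graft A B).clusters = (graft B A).clusters := by
  rw [clusters_graft, clusters_graft, support_graft_comm, Finset.union_comm]

theorem subset_support_of_mem_clusters {T : BinTree V} {u : Finset V} (hu : u ∈ T.clusters) :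
    u ⊆ T.support := by
  induction T with
  | leaf v => simp [clusters] at hu
  | graft A B hA hB =>
    rw [clusters_graft, Finset.mem_insert, Finset.mem_union] at hu
    rcases hu with rfl | h | h
    · exact subset_rfl
    · exact support_graft A B ▸ (hA h).trans Finset.subset_union_left
    · exact support_graft A B ▸ (hB h).trans Finset.subset_union_right

theorem nonempty_of_mem_clusters {T : BinTree V} {u : Finset V} (hu : u ∈ T.clusters) :
    u.Nonempty := by
  induction T with
  | leaf v => simp [clusters] at hu
  | graft A B hA hB =>
    rw [clusters_graft, Finset.mem_insert, Finset.mem_union] at hu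
    rcases hu with rfl | h | h
    exacts [support_nonempty _, hA h, hB h]

theorem not_support_graft_subset_left {A B : BinTree V} (h : Disjoint A.support B.support) :
    ¬ (graft A B).support ⊆ A.support := fun hs =>
  B.support_nonempty.ne_empty <| disjoint_self.1 <|
    h.mono_left ((support_graft A B ▸ Finset.subset_union_right).trans hs)

theorem not_subset_of_mem_clusters {A B : BinTree V} (h : Disjoint A.support B.support)
    {u : Finset V} (hu : u ∈ A.clusters) : ¬ u ⊆ B.support := fun hs =>
  (nonempty_of_mem_clusters hu).ne_empty <| disjoint_self.1 <|
    h.mono (subset_support_of_mem_clusters hu) hs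

theorem clusters_left {A B : BinTree V} (h : Disjoint A.support B.support) :
    A.clusters = (graft A B).clusters.filter (· ⊆ A.support) := by
  ext u
  rw [Finset.mem_filter, clusters_graft, Finset.mem_insert, Finset.mem_union]
  refine ⟨fun hu => ⟨.inr (.inl hu), subset_support_of_mem_clusters hu⟩, ?_⟩
  rintro ⟨rfl | hu | hu, hs⟩
  · exact absurd hs (not_support_graft_subset_left h)
  · exact hu
  · exact absurd hs (not_subset_of_mem_clusters h.symm hu)

theorem clusters_right {A B : BinTree V} (h : Disjoint A.support B.support) :
    B.clusters = (graft A B).clusters.filter (· ⊆ B.support) := by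
  rw [clusters_graft_comm, ← clusters_left h.symm]

theorem support_mem_clusters_or (T : BinTree V) :
    T.support ∈ T.clusters ∨ ∃ v, T.support = {v} := by
  cases T with
  | leaf v => exact .inr ⟨v, support_leaf v⟩
  | graft A B => exact .inl (Finset.mem_insert_self _ _)

theorem support_subset_branch {S A B : BinTree V} (hS : S.clusters ⊆ (graft A B).clusters)
    (hsub : S.support ⊆ (graft A B).support) (hne : S.support ≠ (graft A B).support) :
    S.support ⊆ A.support ∨ S.support ⊆ B.support := by
  rcases S.support_mem_clusters_or with h | ⟨v, hv⟩
  · have h' := hS h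
    rw [clusters_graft, Finset.mem_insert, Finset.mem_union] at h'
    exact (h'.resolve_left hne).imp subset_support_of_mem_clusters subset_support_of_mem_clusters
  · rw [hv] at hsub ⊢
    simpa only [Finset.singleton_subset_iff, support_graft, Finset.mem_union] using hsub

theorem support_left_subset_branch {A B A' B' : BinTree V} (hd : Disjoint A.support B.support)
    (hs : (graft A B).support = (graft A' B').support)
    (hc : (graft A B).clusters = (graft A' B').clusters) :
    A.support ⊆ A'.support ∨ A.support ⊆ B'.support := by
  refine support_subset_branch ?_ ?_ ?_
  · exact hc ▸ clusters_left hd ▸ Finset.filter_subset _ _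
  · exact hs ▸ support_graft A B ▸ Finset.subset_union_left
  · exact fun h => not_support_graft_subset_left hd (hs.trans h.symm).subset

theorem branch_supports_eq_of_subset {A B A' B' : BinTree V}
    (hd' : Disjoint A'.support B'.support)
    (hs : (graft A B).support = (graft A' B').support) (hA : A.support ⊆ A'.support)
    (hB : B.support ⊆ A'.support ∨ B.support ⊆ B'.support) :
    A.support = A'.support ∧ B.support = B'.support := by
  have hB' : B.support ⊆ B'.support := hB.resolve_left fun h =>
    not_support_graft_subset_left hd' (hs ▸ support_graft A B ▸ Finset.union_subset hA h)
  have hle : A'.support ∪ B'.support ⊆ A.support ∪ B.support := by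
    rw [← support_graft, ← support_graft, hs]
  constructor
  · exact hA.antisymm <| (hd'.mono_right hB').left_le_of_le_sup_right
      (Finset.subset_union_left.trans hle)
  · exact hB'.antisymm <| (hd'.symm.mono_right hA).left_le_of_le_sup_left
      (Finset.subset_union_right.trans hle)

theorem branch_supports_eq_or_swap {A B A' B' : BinTree V}
    (hd : Disjoint A.support B.support) (hd' : Disjoint A'.support B'.support)
    (hs : (graft A B).support = (graft A' B').support)
    (hc : (graft A B).clusters = (graft A' B').clusters) :
    (A.support = A'.support ∧ B.support = B'.support) ∨
      (A.support = B'.support ∧ B.support = A'.support) := by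
  have hB := support_left_subset_branch hd.symm (support_graft_comm A B ▸ hs)
    (clusters_graft_comm A B ▸ hc)
  refine (support_left_subset_branch hd hs hc).imp (fun hA => ?_) (fun hA => ?_)
  · exact branch_supports_eq_of_subset hd' hs hA hB
  · exact branch_supports_eq_of_subset hd'.symm (support_graft_comm A' B' ▸ hs) hA hB.symm

theorem swapEquiv_of_clusters_eq {T T' : BinTree V} (h : T.labels.Nodup) (h' : T'.labels.Nodup)
    (hs : T.support = T'.support) (hc : T.clusters = T'.clusters) : SwapEquiv T T' := by
  induction T generalizing T' with
  | leaf v =>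
    cases T' with
    | leaf w =>
      rw [support_leaf, support_leaf, Finset.singleton_inj] at hs
      exact hs ▸ .leaf v
    | graft A' B' => exact absurd hc.symm (Finset.insert_ne_empty _ _)
  | graft A B ihA ihB =>
    cases T' with
    | leaf w => exact absurd hc (Finset.insert_ne_empty _ _)
    | graft A' B' =>
      obtain ⟨hA, hB, hd⟩ := nodup_graft.1 h
      obtain ⟨hA', hB', hd'⟩ := nodup_graft.1 h'
      rcases branch_supports_eq_or_swap hd hd' hs hc with ⟨e1, e2⟩ | ⟨e1, e2⟩
      · refine .congr (ihA hA hA' e1 ?_) (ihB hB hB' e2 ?_)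
        · rw [clusters_left hd, clusters_left hd', hc, e1]
        · rw [clusters_right hd, clusters_right hd', hc, e2]
      · refine .swap (ihA hA hB' e1 ?_) (ihB hB hA' e2 ?_)
        · rw [clusters_left hd, clusters_right hd', hc, e1]
        · rw [clusters_right hd, clusters_left hd', hc, e2]

end BinTree

namespace Diagram

variable {𝔗 : Set ℝ} {V E : Type*} [Fintype E] (Γ : Diagram 𝔗 V E)

/-- The edges with both endpoints in `U`. -/
def edgesIn (U : Finset V) : Finset E :=
  Finset.univ.filter (fun e => Γ.src e ∈ U ∧ Γ.tgt e ∈ U)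

/-- The edges joining `U` and `W`, in either direction. -/
def cross (U W : Finset V) : Finset E :=
  Finset.univ.filter (fun e => (Γ.src e ∈ U ∧ Γ.tgt e ∈ W) ∨ (Γ.src e ∈ W ∧ Γ.tgt e ∈ U))

theorem mem_edgesIn {U : Finset V} {e : E} :
    e ∈ Γ.edgesIn U ↔ Γ.src e ∈ U ∧ Γ.tgt e ∈ U := by simp [edgesIn]

theorem mem_cross {U W : Finset V} {e : E} :
    e ∈ Γ.cross U W ↔ (Γ.src e ∈ U ∧ Γ.tgt e ∈ W) ∨ (Γ.src e ∈ W ∧ Γ.tgt e ∈ U) := by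
  simp [cross]

theorem cross_comm (U W : Finset V) : Γ.cross U W = Γ.cross W U := by
  ext e
  rw [mem_cross, mem_cross, or_comm]

@[to_additive]
theorem prod_edgesIn_union {M : Type*} [CommMonoid M] {U W : Finset V}
    (h : Disjoint U W) (f : E → M) :
    ∏ e ∈ Γ.edgesIn (U ∪ W), f e =
      (∏ e ∈ Γ.cross U W, f e) * ((∏ e ∈ Γ.edgesIn U, f e) * ∏ e ∈ Γ.edgesIn W, f e) := by
  have hd : ∀ v, v ∈ U → v ∉ W := fun v hU => Finset.disjoint_left.1 h hU
  have hunion : Γ.edgesIn (U ∪ W) = Γ.cross U W ∪ (Γ.edgesIn U ∪ Γ.edgesIn W) := by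
    ext e
    simp only [Finset.mem_union, mem_edgesIn, mem_cross]
    tauto
  rw [hunion, Finset.prod_union, Finset.prod_union] <;> rw [Finset.disjoint_left]
  all_goals
    intro e
    simp only [Finset.mem_union, mem_edgesIn, mem_cross]
    grind

theorem null_clusters_leaf (d : ℕ) (v : V) : Γ.null d (BinTree.leaf v).clusters = 0 := by
  simp [null, BinTree.clusters]

theorem null_clusters_graft (d : ℕ) {A B : BinTree V} (h : Disjoint A.support B.support) :
    Γ.null d (BinTree.graft A B).clusters =
      Γ.null d A.clusters + Γ.null d B.clusters +
        if Γ.degBar d (A.support ∪ B.support) = 0 then 1 else 0 := by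
  have hroot : (BinTree.graft A B).support ∉ A.clusters ∪ B.clusters := by
    rw [Finset.mem_union]
    rintro (hu | hu) <;> have hs := BinTree.subset_support_of_mem_clusters hu
    · exact BinTree.not_support_graft_subset_left h hs
    · exact BinTree.not_support_graft_subset_left h.symm (BinTree.support_graft_comm A B ▸ hs)
  have hdisj : Disjoint A.clusters B.clusters := Finset.disjoint_left.2 fun u hu hu' =>
    BinTree.not_subset_of_mem_clusters h hu (BinTree.subset_support_of_mem_clusters hu')
  simp only [null, BinTree.clusters_graft, Finset.card_filter]
  rw [Finset.sum_insert hroot, Finset.sum_union hdisj, BinTree.support_graft, add_comm]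

/-! ### Single-linkage clustering -/

/-- `Γ.Linked s N T n`: the inner nodes of `T` can be labelled by scales between `n` and `N`,
increasing away from the root, in such a way that the label `m` of a node is the largest scale `s e`
of an edge `e` joining its two branches, or is `0`. -/
def Linked (s : E → ℕ) (N : ℕ) : BinTree V → ℕ → Prop
  | .leaf _, n => n ≤ N
  | .graft A B, n => ∃ m, n ≤ m ∧ m ≤ N ∧ Linked s N A m ∧ Linked s N B m ∧
      (∀ e ∈ Γ.cross A.support B.support, s e ≤ m) ∧
      (m = 0 ∨ ∃ e ∈ Γ.cross A.support B.support, s e = m)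

/-- The edges inside `X` whose endpoints lie in different trees of the forest `𝓕`. -/
def separated (𝓕 : Multiset (BinTree V)) (X : Finset V) : Finset E :=
  (Γ.edgesIn X).filter (fun e => ∀ T ∈ 𝓕, ¬ (Γ.src e ∈ T.support ∧ Γ.tgt e ∈ T.support))

/-- An intermediate stage of single-linkage clustering: a partition of `X` into trees that are
linked at scales at least `n`, while all edges between different trees have scale at most `n`. -/
structure LinkedForest (s : E → ℕ) (N : ℕ) (X : Finset V) (𝓕 : Multiset (BinTree V)) (n : ℕ) :
    Prop where
  labels_sum : (𝓕.map BinTree.labels).sum = X.val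
  scale_le_max : n ≤ N
  linked : ∀ T ∈ 𝓕, Γ.Linked s N T n
  scale_le : ∀ e ∈ Γ.separated 𝓕 X, s e ≤ n

variable {Γ} {s : E → ℕ} {N : ℕ} {X : Finset V} {𝓕 : Multiset (BinTree V)}

theorem Linked.anti {T : BinTree V} {n n' : ℕ} (h : Γ.Linked s N T n) (hn : n' ≤ n) :
    Γ.Linked s N T n' := by
  cases T with
  | leaf v => exact hn.trans h
  | graft A B =>
    obtain ⟨m, h1, h2⟩ := h
    exact ⟨m, hn.trans h1, h2⟩

theorem mem_iff_of_labels_sum_eq (hX : (𝓕.map BinTree.labels).sum = X.val) {v : V} :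
    v ∈ X ↔ ∃ T ∈ 𝓕, v ∈ T.support := by
  rw [← Finset.mem_val, ← hX, BinTree.mem_sum_labels]

theorem exists_pair_linked_at_sup (s : E → ℕ) (hX : (𝓕.map BinTree.labels).sum = X.val)
    (hcard : 2 ≤ 𝓕.card) :
    ∃ A B R, 𝓕 = A ::ₘ B ::ₘ R ∧ ((Γ.separated 𝓕 X).sup s = 0 ∨
      ∃ e ∈ Γ.cross A.support B.support, s e = (Γ.separated 𝓕 X).sup s) := by
  rcases (Γ.separated 𝓕 X).eq_empty_or_nonempty with hempty | hne
  · obtain ⟨A, hA⟩ := Multiset.card_pos_iff_exists_mem.1 (by omega : 0 < 𝓕.card)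
    obtain ⟨𝓕', rfl⟩ := Multiset.exists_cons_of_mem hA
    rw [Multiset.card_cons] at hcard
    obtain ⟨B, hB⟩ := Multiset.card_pos_iff_exists_mem.1 (by omega : 0 < 𝓕'.card)
    obtain ⟨R, rfl⟩ := Multiset.exists_cons_of_mem hB
    exact ⟨A, B, R, rfl, .inl (by rw [hempty, Finset.sup_empty]; rfl)⟩
  · obtain ⟨e, he, hse⟩ := Finset.exists_mem_eq_sup _ hne s
    rw [separated, Finset.mem_filter, mem_edgesIn] at he
    obtain ⟨⟨hsrc, htgt⟩, hsep⟩ := he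
    obtain ⟨A, hA, hvA⟩ := (mem_iff_of_labels_sum_eq hX).1 hsrc
    obtain ⟨B, hB, hvB⟩ := (mem_iff_of_labels_sum_eq hX).1 htgt
    have hBA : B ≠ A := by
      rintro rfl
      exact hsep B hA ⟨hvA, hvB⟩
    obtain ⟨𝓕', rfl⟩ := Multiset.exists_cons_of_mem hA
    obtain ⟨R, rfl⟩ := Multiset.exists_cons_of_mem ((Multiset.mem_cons.1 hB).resolve_left hBA)
    exact ⟨A, B, R, rfl, .inr ⟨e, (mem_cross _).2 (.inl ⟨hvA, hvB⟩), hse.symm⟩⟩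

theorem cross_subset_separated {A B : BinTree V} {R : Multiset (BinTree V)}
    (hX : ((A ::ₘ B ::ₘ R).map BinTree.labels).sum = X.val) :
    Γ.cross A.support B.support ⊆ Γ.separated (A ::ₘ B ::ₘ R) X := by
  have hnd := X.nodup
  rw [← hX, Multiset.map_cons, Multiset.map_cons, Multiset.sum_cons, Multiset.sum_cons,
    Multiset.nodup_add, Multiset.nodup_add] at hnd
  obtain ⟨-, ⟨-, -, hBR⟩, hA⟩ := hnd
  have hsep : ∀ v ∈ A.support, ∀ w ∈ B.support, ∀ T ∈ A ::ₘ B ::ₘ R,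
      ¬ (v ∈ T.support ∧ w ∈ T.support) := by
    rintro v hv w hw T hT ⟨hvT, hwT⟩
    rw [BinTree.mem_support] at hv hw
    rw [Multiset.mem_cons, Multiset.mem_cons] at hT
    rcases hT with rfl | rfl | hT
    · exact Multiset.disjoint_left.1 hA (BinTree.mem_support.1 hwT)
        (Multiset.mem_add.2 (.inl hw))
    · exact Multiset.disjoint_left.1 hA hv (Multiset.mem_add.2 (.inl (BinTree.mem_support.1 hvT)))
    · exact Multiset.disjoint_left.1 hBR hw (BinTree.mem_sum_labels.2 ⟨T, hT, hwT⟩)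
  have hAX : A.support ⊆ X := fun v hv =>
    (mem_iff_of_labels_sum_eq hX).2 ⟨A, by simp, hv⟩
  have hBX : B.support ⊆ X := fun v hv =>
    (mem_iff_of_labels_sum_eq hX).2 ⟨B, by simp, hv⟩
  intro e he
  rw [separated, Finset.mem_filter, mem_edgesIn]
  rcases (mem_cross _).1 he with h | h
  · exact ⟨⟨hAX h.1, hBX h.2⟩, hsep _ h.1 _ h.2⟩
  · exact ⟨⟨hBX h.1, hAX h.2⟩, fun T hT hT' => hsep _ h.2 _ h.1 T hT hT'.symm⟩

theorem separated_graft_subset (A B : BinTree V) (R : Multiset (BinTree V)) :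
    Γ.separated (.graft A B ::ₘ R) X ⊆ Γ.separated (A ::ₘ B ::ₘ R) X := by
  intro e he
  simp only [separated, Finset.mem_filter, Multiset.forall_mem_cons, BinTree.support_graft,
    Finset.mem_union] at he ⊢
  tauto

/-- The two trees to be joined are those connected by an edge of the largest scale among the
separated edges. -/
theorem LinkedForest.exists_merge {n : ℕ} (h : Γ.LinkedForest s N X 𝓕 n) (hcard : 2 ≤ 𝓕.card) :
    ∃ 𝓕' m, Γ.LinkedForest s N X 𝓕' m ∧ 𝓕.card = 𝓕'.card + 1 := by
  obtain ⟨A, B, R, rfl, hAB⟩ := exists_pair_linked_at_sup (Γ := Γ) s h.labels_sum hcard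
  set m := (Γ.separated (A ::ₘ B ::ₘ R) X).sup s
  have hmn : m ≤ n := Finset.sup_le h.scale_le
  have hlinked : ∀ T ∈ A ::ₘ B ::ₘ R, Γ.Linked s N T m := fun T hT => (h.linked T hT).anti hmn
  have hroot : Γ.Linked s N (.graft A B) m :=
    ⟨m, le_rfl, hmn.trans h.scale_le_max, hlinked A (by simp), hlinked B (by simp),
      fun e he => Finset.le_sup (f := s) (cross_subset_separated h.labels_sum he), hAB⟩
  refine ⟨.graft A B ::ₘ R, m, ⟨?_, hmn.trans h.scale_le_max, ?_, fun e he => ?_⟩, by simp⟩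
  · rw [← h.labels_sum]
    simp only [Multiset.map_cons, Multiset.sum_cons, BinTree.labels, add_assoc]
  · exact Multiset.forall_mem_cons.2 ⟨hroot, fun T hT => hlinked T (by simp [hT])⟩
  · exact Finset.le_sup (f := s) (separated_graft_subset A B R he)

theorem LinkedForest.exists_tree {n : ℕ} (h : Γ.LinkedForest s N X 𝓕 n) (hcard : 1 ≤ 𝓕.card) :
    ∃ T : BinTree V, T.labels = X.val ∧ Γ.Linked s N T 0 := by
  obtain ⟨c, hc⟩ := Nat.exists_eq_add_of_le' hcard
  induction c generalizing 𝓕 n with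
  | zero =>
    obtain ⟨T, rfl⟩ := Multiset.card_eq_one.1 hc
    exact ⟨T, by simpa using h.labels_sum, (h.linked T (by simp)).anti n.zero_le⟩
  | succ c ih =>
    obtain ⟨𝓕', m, h', hc'⟩ := h.exists_merge (by omega)
    exact ih h' (by omega) (by omega)

theorem exists_linked (hs : ∀ e, s e ≤ N) (hX : X.Nonempty) :
    ∃ T : BinTree V, T.labels = X.val ∧ Γ.Linked s N T 0 := by
  have hforest : Γ.LinkedForest s N X (X.val.map .leaf) N := by
    refine ⟨?_, le_rfl, fun T hT => ?_, fun e _ => hs e⟩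
    · rw [Multiset.map_map]
      exact Multiset.sum_map_singleton _
    · obtain ⟨v, -, rfl⟩ := Multiset.mem_map.1 hT
      exact le_rfl
  exact hforest.exists_tree (by simpa using hX)

end Diagram

/-! ### Power counting -/

theorem sum_Icc_zpow_le {D : ℤ} (hD : 0 ≤ D) {n N : ℕ} {L : ℝ} (hL : 1 ≤ L)
    (hN : (N : ℝ) + 1 ≤ 3 * L) (p : ℕ) (hp : D = 0 → p = 1) :
    ∑ m ∈ Finset.Icc n N, (2 : ℝ) ^ (-(m : ℤ) * D) ≤ 3 * (2 : ℝ) ^ (-(n : ℤ) * D) * L ^ p := by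
  rcases hD.eq_or_lt with rfl | hD
  · have hcard : ((N + 1 - n : ℕ) : ℝ) ≤ N + 1 := by exact_mod_cast Nat.sub_le _ _
    simpa [hp rfl] using hcard.trans hN
  · have hterm : ∀ m ∈ Finset.Icc n N, (2 : ℝ) ^ (-(m : ℤ) * D) ≤
        (2 : ℝ) ^ (-(n : ℤ) * D) * (1 / 2) ^ (m - n) := by
      intro m hm
      have hnm := (Finset.mem_Icc.1 hm).1
      have hhalf : ((1 : ℝ) / 2) ^ (m - n) = 2 ^ (-((m - n : ℕ) : ℤ)) := by
        rw [zpow_neg, zpow_natCast, one_div, inv_pow]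
      rw [hhalf, ← zpow_add₀ two_ne_zero, Nat.cast_sub hnm]
      have : (n : ℤ) ≤ m := by exact_mod_cast hnm
      exact zpow_le_zpow_right₀ one_le_two (by nlinarith)
    have hgeom : ∑ m ∈ Finset.Icc n N, ((1 : ℝ) / 2) ^ (m - n) ≤ 2 := by
      rw [← Finset.Ico_succ_right_eq_Icc, Finset.sum_Ico_eq_sum_range]
      simpa using sum_geometric_two_le (N + 1 - n)
    calc ∑ m ∈ Finset.Icc n N, (2 : ℝ) ^ (-(m : ℤ) * D)
        ≤ (2 : ℝ) ^ (-(n : ℤ) * D) * ∑ m ∈ Finset.Icc n N, ((1 : ℝ) / 2) ^ (m - n) := by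
          rw [Finset.mul_sum]
          exact Finset.sum_le_sum hterm
      _ ≤ (2 : ℝ) ^ (-(n : ℤ) * D) * 3 := by gcongr; linarith
      _ ≤ 3 * (2 : ℝ) ^ (-(n : ℤ) * D) * L ^ p := by
          rw [mul_comm]
          exact le_mul_of_one_le_right (by positivity) (one_le_pow₀ hL)

namespace Diagram

variable {𝔗 : Set ℝ} {V E : Type*} (Γ : Diagram 𝔗 V E)

/-- The order `max (-𝔱(e)) 0` of the singularity of the kernel at an edge `e` of integer type. -/
def singOrder (e : E) : ℕ := ⌊-(Γ.type e : ℝ)⌋₊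

theorem singOrder_eq_zero {e : E} (ht : 0 ≤ (Γ.type e : ℝ)) : Γ.singOrder e = 0 :=
  Nat.floor_eq_zero.2 (by linarith)

theorem singOrder_eq_neg_type {e : E} (hZ : ∃ n : ℤ, (Γ.type e : ℝ) = n)
    (ht : (Γ.type e : ℝ) ≤ 0) : (Γ.singOrder e : ℝ) = -(Γ.type e : ℝ) := by
  obtain ⟨n, hn⟩ := hZ
  have hn0 : n ≤ 0 := by
    rw [hn] at ht
    exact_mod_cast ht
  obtain ⟨k, rfl⟩ := Int.exists_eq_neg_ofNat hn0
  simp [singOrder, hn]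

variable {Γ} in
/-- Joining the connected components into one can only increase the degree. -/
theorem Subdiagram.deg_le [Fintype V] (d : ℕ) (S : Γ.Subdiagram) (hS : S.verts.Nonempty) :
    S.deg d ≤ d * ((S.verts.card : ℝ) - 1) + ∑ e ∈ S.edges, (Γ.type e : ℝ) := by
  have hcomp : (1 : ℝ) ≤ ((S.verts.image S.graph.connectedComponentMk).card : ℝ) := by
    exact_mod_cast (hS.image _).card_pos
  rw [Subdiagram.deg, Finset.sum_add_distrib, ← Finset.mul_sum, Finset.sum_sub_distrib,
    Finset.sum_fiberwise_of_maps_to (g := fun e => S.graph.connectedComponentMk (Γ.src e))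
      (fun e he => Finset.mem_image_of_mem _ (S.src_mem e he)) (fun e => (Γ.type e : ℝ)),
    ← Nat.cast_sum, ← Finset.card_eq_sum_card_image]
  gcongr
  simpa using hcomp

variable [Fintype E]

theorem mem_innerEdges [Fintype V] {e : E} :
    e ∈ Γ.innerEdges ↔ Γ.src e ∈ Γ.inner ∧ Γ.tgt e ∈ Γ.inner := by
  simp [innerEdges]

theorem edgesIn_inner [Fintype V] : Γ.edgesIn Γ.inner = Γ.innerEdges := by
  ext e
  rw [mem_edgesIn, mem_innerEdges]

theorem edgesIn_subset_innerEdges [Fintype V] {U : Finset V} (hU : U ⊆ Γ.inner) :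
    Γ.edgesIn U ⊆ Γ.innerEdges := fun e he => by
  rw [mem_edgesIn] at he
  exact Γ.mem_innerEdges.2 ⟨hU he.1, hU he.2⟩

/-- The types of the inner edges are integers. -/
def IntegerTypes [Fintype V] : Prop := ∀ e ∈ Γ.innerEdges, ∃ n : ℤ, (Γ.type e : ℝ) = n

variable {Γ} in
/-- Non-negativity of the subdiagram formed by the edges of negative type. -/
theorem NonNegative.sum_singOrder_le [Fintype V] {d : ℕ} (h : Γ.NonNegative d)
    (hZ : Γ.IntegerTypes) {U : Finset V} (hU : U.Nonempty) (hsub : U ⊆ Γ.inner) :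
    (∑ e ∈ Γ.edgesIn U, Γ.singOrder e : ℝ) ≤ d * ((U.card : ℝ) - 1) := by
  let S : Γ.Subdiagram :=
    { verts := U
      edges := (Γ.edgesIn U).filter fun e => (Γ.type e : ℝ) < 0
      verts_subset := hsub
      src_mem := fun e he => (Γ.mem_edgesIn.1 (Finset.mem_filter.1 he).1).1
      tgt_mem := fun e he => (Γ.mem_edgesIn.1 (Finset.mem_filter.1 he).1).2 }
  have hdeg : 0 ≤ d * ((U.card : ℝ) - 1) + ∑ e ∈ S.edges, (Γ.type e : ℝ) :=
    (h S).trans (S.deg_le d hU)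
  have hsum : (∑ e ∈ Γ.edgesIn U, Γ.singOrder e : ℝ) = -∑ e ∈ S.edges, (Γ.type e : ℝ) := by
    rw [← Finset.sum_neg_distrib, Finset.sum_filter]
    refine Finset.sum_congr rfl fun e he => ?_
    split_ifs with ht
    · exact Γ.singOrder_eq_neg_type (hZ e (Γ.edgesIn_subset_innerEdges hsub he)) ht.le
    · rw [singOrder_eq_zero _ (not_lt.1 ht), Nat.cast_zero]
  linarith

/-- `1` if `U` spans an edge of positive type, and `0` otherwise. -/
def posIndicator (U : Finset V) : ℕ := if ∃ e ∈ Γ.edgesIn U, 0 < (Γ.type e : ℝ) then 1 else 0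

/-- `1` if `U ∪ W` spans an edge of positive type although neither `U` nor `W` does, and `0`
otherwise. -/
def newPos (U W : Finset V) : ℕ :=
  Γ.posIndicator (U ∪ W) - (Γ.posIndicator U + Γ.posIndicator W)

variable {Γ} in
theorem posIndicator_eq_one_iff {U : Finset V} :
    Γ.posIndicator U = 1 ↔ ∃ e ∈ Γ.edgesIn U, 0 < (Γ.type e : ℝ) := by
  simp [posIndicator]

theorem posIndicator_eq_zero_or_one (U : Finset V) :
    Γ.posIndicator U = 0 ∨ Γ.posIndicator U = 1 := by
  unfold posIndicator
  split_ifs <;> simp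

variable {Γ} in
theorem type_nonpos_of_posIndicator_eq_zero {U : Finset V} (h : Γ.posIndicator U = 0) {e : E}
    (he : e ∈ Γ.edgesIn U) : (Γ.type e : ℝ) ≤ 0 := by
  by_contra! ht
  exact one_ne_zero ((posIndicator_eq_one_iff.2 ⟨e, he, ht⟩).symm.trans h)

theorem posIndicator_mono {U W : Finset V} (h : U ⊆ W) : Γ.posIndicator U ≤ Γ.posIndicator W := by
  rcases Γ.posIndicator_eq_zero_or_one U with hU | hU
  · omega
  · obtain ⟨e, he, ht⟩ := posIndicator_eq_one_iff.1 hU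
    rw [mem_edgesIn] at he
    rw [hU, posIndicator_eq_one_iff.2 ⟨e, Γ.mem_edgesIn.2 ⟨h he.1, h he.2⟩, ht⟩]

theorem newPos_comm (U W : Finset V) : Γ.newPos U W = Γ.newPos W U := by
  rw [newPos, newPos, Finset.union_comm, add_comm (Γ.posIndicator U)]

theorem newPos_eq_zero_or (U W : Finset V) :
    Γ.newPos U W = 0 ∨ (Γ.newPos U W = 1 ∧ Γ.posIndicator U = 0 ∧ Γ.posIndicator W = 0 ∧
      Γ.posIndicator (U ∪ W) = 1) := by
  have := Γ.posIndicator_eq_zero_or_one (U ∪ W)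
  rw [newPos]
  omega

/-- Minus the exponent of `2 ^ n` in the contribution of a cluster `U` of scale at least `n`.
Edges of positive type enter only through one factor of the diameter of the cluster, which is
enough for a cluster spanning such an edge to have positive excess. -/
def excess (d : ℕ) (U : Finset V) : ℤ :=
  d * ((U.card : ℤ) - 1) - ∑ e ∈ Γ.edgesIn U, (Γ.singOrder e : ℤ) + Γ.posIndicator U

theorem excess_singleton_le (d : ℕ) (v : V) : Γ.excess d {v} ≤ Γ.posIndicator {v} := by
  have : 0 ≤ ∑ e ∈ Γ.edgesIn {v}, (Γ.singOrder e : ℤ) := Finset.sum_nonneg fun _ _ => by positivity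
  simpa [excess] using this

theorem excess_union_le (d : ℕ) {U W : Finset V} (h : Disjoint U W) :
    Γ.excess d (U ∪ W) ≤ Γ.excess d U + Γ.excess d W + d -
      ∑ e ∈ Γ.cross U W, (Γ.singOrder e : ℤ) + Γ.newPos U W := by
  have hpos : (Γ.posIndicator (U ∪ W) : ℤ) ≤
      Γ.posIndicator U + Γ.posIndicator W + Γ.newPos U W := by
    rw [newPos]
    omega
  rw [excess, excess, excess, Γ.sum_edgesIn_union h, Finset.card_union_of_disjoint h]
  push_cast
  linarith

section NonNegative

variable {Γ} [Fintype V] {d : ℕ}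

theorem NonNegative.posIndicator_le_excess (h : Γ.NonNegative d) (hZ : Γ.IntegerTypes)
    {U : Finset V} (hU : U.Nonempty) (hsub : U ⊆ Γ.inner) :
    (Γ.posIndicator U : ℤ) ≤ Γ.excess d U := by
  have hsum : ∑ e ∈ Γ.edgesIn U, (Γ.singOrder e : ℤ) ≤ d * ((U.card : ℤ) - 1) := by
    exact_mod_cast h.sum_singOrder_le hZ hU hsub
  rw [excess]
  linarith

theorem NonNegative.degBar_eq_zero (h : Γ.NonNegative d) (hZ : Γ.IntegerTypes)
    {U : Finset V} (hU : U.Nonempty) (hsub : U ⊆ Γ.inner) (h0 : Γ.excess d U = 0) :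
    Γ.degBar d U = 0 := by
  have hpos : Γ.posIndicator U = 0 := by
    have := h.posIndicator_le_excess hZ hU hsub
    omega
  have hsum : (∑ e ∈ Γ.edgesIn U, Γ.singOrder e : ℝ) = -∑ e ∈ Γ.edgesIn U, (Γ.type e : ℝ) := by
    rw [← Finset.sum_neg_distrib]
    exact Finset.sum_congr rfl fun e he => Γ.singOrder_eq_neg_type
      (hZ e (Γ.edgesIn_subset_innerEdges hsub he)) (type_nonpos_of_posIndicator_eq_zero hpos he)
  have hcast : (d : ℝ) * ((U.card : ℝ) - 1) - (∑ e ∈ Γ.edgesIn U, Γ.singOrder e : ℝ) = 0 := by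
    rw [excess, hpos] at h0
    simpa using congrArg (Int.cast : ℤ → ℝ) h0
  rwa [hsum, sub_neg_eq_add] at hcast

end NonNegative

/-- The factor contributed at scale `m` by the merger of the clusters `U` and `W`: the singularities
of the edges between them, and a bound for the diameter of `U ∪ W` if the first edge of positive
type appears. -/
def growth (U W : Finset V) (m : ℕ) : ℝ :=
  2 ^ (m * ∑ e ∈ Γ.cross U W, Γ.singOrder e) * (4 * (U.card + W.card) / 2 ^ m) ^ Γ.newPos U W

theorem growth_nonneg (U W : Finset V) (m : ℕ) : 0 ≤ Γ.growth U W m := by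
  unfold growth
  positivity

theorem growth_comm (U W : Finset V) (m : ℕ) : Γ.growth U W m = Γ.growth W U m := by
  rw [growth, growth, Γ.cross_comm, Γ.newPos_comm, add_comm (U.card : ℝ)]

/-- An upper bound for the product of the diameter bounds `4 * card` over the minimal clusters
inside `U` spanning an edge of positive type. -/
def posConst (U : Finset V) : ℝ := if Γ.posIndicator U = 0 then 1 else 8 ^ U.card

theorem one_le_posConst (U : Finset V) : 1 ≤ Γ.posConst U := by
  unfold posConst
  split_ifs
  exacts [le_rfl, one_le_pow₀ (by norm_num)]

theorem posConst_le (U : Finset V) : Γ.posConst U ≤ 8 ^ U.card := by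
  unfold posConst
  split_ifs
  exacts [one_le_pow₀ (by norm_num), le_rfl]

theorem posConst_union {U W : Finset V} (h : Disjoint U W) :
    (4 * (U.card + W.card : ℝ)) ^ Γ.newPos U W * (Γ.posConst U * Γ.posConst W) ≤
      Γ.posConst (U ∪ W) := by
  rcases Γ.newPos_eq_zero_or U W with h0 | ⟨h1, hU, hW, hUW⟩
  · rw [h0, pow_zero, one_mul]
    rcases Γ.posIndicator_eq_zero_or_one (U ∪ W) with hUW | hUW
    · have hU := Γ.posIndicator_mono (Finset.subset_union_left (s₁ := U) (s₂ := W))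
      have hW := Γ.posIndicator_mono (Finset.subset_union_right (s₁ := U) (s₂ := W))
      rw [posConst, posConst, posConst, if_pos (by omega), if_pos (by omega), if_pos hUW, one_mul]
    · rw [posConst.eq_1 Γ (U ∪ W), if_neg (by omega), Finset.card_union_of_disjoint h, pow_add]
      exact mul_le_mul (Γ.posConst_le U) (Γ.posConst_le W)
        (zero_le_one.trans (Γ.one_le_posConst W)) (by positivity)
  · rw [posConst, posConst, posConst, if_pos hU, if_pos hW, if_neg (by omega), h1, pow_one,
      mul_one, mul_one, Finset.card_union_of_disjoint h]
    obtain ⟨e, he, -⟩ := posIndicator_eq_one_iff.1 hUW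
    have hcard : U.card + W.card ≠ 0 := by
      rw [← Finset.card_union_of_disjoint h]
      exact Finset.card_ne_zero_of_mem (Γ.mem_edgesIn.1 he).1
    rw [← Nat.cast_add]
    generalize U.card + W.card = k at hcard
    have hk : (k : ℝ) ≤ 2 ^ k := by exact_mod_cast Nat.lt_two_pow_self.le
    calc (4 : ℝ) * k ≤ 4 ^ k * 2 ^ k := by gcongr; exact le_self_pow₀ (by norm_num) hcard
      _ = 8 ^ k := by rw [← mul_pow]; norm_num

/-- The bound for the contribution of a cluster `U` of scale at least `n`, up to logarithms; `κ`
stands for the volume of the torus. -/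
def clusterBound (d : ℕ) (κ : ℝ) (U : Finset V) (n : ℕ) : ℝ :=
  Γ.posConst U * (3 * κ) ^ (U.card - 1) * 2 ^ (Γ.edgesIn U).card *
    (2 : ℝ) ^ (-(n : ℤ) * Γ.excess d U)

theorem clusterBound_nonneg (d : ℕ) {κ : ℝ} (hκ : 0 ≤ κ) (U : Finset V) (n : ℕ) :
    0 ≤ Γ.clusterBound d κ U n := by
  have := zero_le_one.trans (Γ.one_le_posConst U)
  unfold clusterBound
  positivity

theorem le_clusterBound_singleton (d : ℕ) (κ : ℝ) (v : V) (n : ℕ) :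
    (1 / 2) ^ (n * Γ.posIndicator {v}) ≤ Γ.clusterBound d κ {v} n := by
  have hpow : ((1 : ℝ) / 2) ^ (n * Γ.posIndicator {v}) ≤ 2 ^ (-(n : ℤ) * Γ.excess d {v}) := by
    rw [one_div, inv_pow, ← zpow_natCast, ← zpow_neg]
    refine zpow_le_zpow_right₀ one_le_two ?_
    push_cast
    nlinarith [Γ.excess_singleton_le d v]
  rw [clusterBound, Finset.card_singleton, Nat.sub_self, pow_zero, mul_one]
  refine hpow.trans (le_mul_of_one_le_left (by positivity) ?_)
  exact one_le_mul_of_one_le_of_one_le (Γ.one_le_posConst _) (one_le_pow₀ one_le_two)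

theorem scale_factor_union_le (d : ℕ) {U W : Finset V} (h : Disjoint U W) (m : ℕ) :
    (2 : ℝ) ^ (m * ∑ e ∈ Γ.cross U W, Γ.singOrder e) * (1 / 2 ^ m) ^ Γ.newPos U W *
      (1 / 2 ^ (d * m)) *
        ((2 : ℝ) ^ (-(m : ℤ) * Γ.excess d U) * (2 : ℝ) ^ (-(m : ℤ) * Γ.excess d W)) ≤
      (2 : ℝ) ^ (-(m : ℤ) * Γ.excess d (U ∪ W)) := by
  rw [one_div, one_div, inv_pow, ← pow_mul]
  simp only [← zpow_natCast, ← zpow_neg, ← zpow_add₀ (two_ne_zero (α := ℝ))]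
  refine zpow_le_zpow_right₀ one_le_two ?_
  push_cast
  nlinarith [Γ.excess_union_le d h]

theorem clusterBound_union {d : ℕ} {κ : ℝ} (hκ : 0 ≤ κ) {U W : Finset V} (h : Disjoint U W)
    (hU : U.Nonempty) (hW : W.Nonempty) (m : ℕ) :
    3 * (Γ.growth U W m * (2 ^ (Γ.cross U W).card * κ / 2 ^ (d * m)) *
      (Γ.clusterBound d κ U m * Γ.clusterBound d κ W m)) ≤ Γ.clusterBound d κ (U ∪ W) m := by
  have hcard : (U ∪ W).card - 1 = (U.card - 1) + (W.card - 1) + 1 := by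
    have := hU.card_pos
    have := hW.card_pos
    rw [Finset.card_union_of_disjoint h]
    omega
  have hedges : (Γ.edgesIn (U ∪ W)).card =
      (Γ.cross U W).card + ((Γ.edgesIn U).card + (Γ.edgesIn W).card) := by
    simp only [Finset.card_eq_sum_ones, Γ.sum_edgesIn_union h]
  have hpos := zero_le_one.trans (Γ.one_le_posConst (U ∪ W))
  rw [clusterBound.eq_1 Γ d κ (U ∪ W), hcard, hedges]
  calc _ = (4 * (U.card + W.card : ℝ)) ^ Γ.newPos U W * (Γ.posConst U * Γ.posConst W) *
        (3 * κ) ^ (U.card - 1 + (W.card - 1) + 1) *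
        2 ^ ((Γ.cross U W).card + ((Γ.edgesIn U).card + (Γ.edgesIn W).card)) *
        (2 ^ (m * ∑ e ∈ Γ.cross U W, Γ.singOrder e) * (1 / 2 ^ m) ^ Γ.newPos U W *
          (1 / 2 ^ (d * m)) *
          ((2 : ℝ) ^ (-(m : ℤ) * Γ.excess d U) * (2 : ℝ) ^ (-(m : ℤ) * Γ.excess d W))) := by
        rw [growth, clusterBound, clusterBound, div_eq_mul_one_div (4 * _) (2 ^ m),
          mul_pow (4 * _)]
        simp only [pow_add]
        ring
    _ ≤ _ := by
        gcongr
        exacts [Γ.posConst_union h, Γ.scale_factor_union_le d h m]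

variable {Γ} in
theorem NonNegative.sum_clusterBound_le [Fintype V] {d : ℕ} (h : Γ.NonNegative d)
    (hZ : Γ.IntegerTypes) {κ L : ℝ} (hκ : 0 ≤ κ) (hL : 1 ≤ L) {N : ℕ}
    (hN : (N : ℝ) + 1 ≤ 3 * L) {U : Finset V} (hU : U.Nonempty) (hsub : U ⊆ Γ.inner) (n : ℕ) :
    ∑ m ∈ Finset.Icc n N, Γ.clusterBound d κ U m ≤
      3 * Γ.clusterBound d κ U n * L ^ (if Γ.degBar d U = 0 then 1 else 0) := by
  have hexcess : 0 ≤ Γ.excess d U :=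
    (Int.natCast_nonneg _).trans (h.posIndicator_le_excess hZ hU hsub)
  have hgeom := sum_Icc_zpow_le hexcess (n := n) hL hN (if Γ.degBar d U = 0 then 1 else 0)
    fun h0 => if_pos (h.degBar_eq_zero hZ hU hsub h0)
  have hpos := zero_le_one.trans (Γ.one_le_posConst U)
  simp only [clusterBound, ← Finset.mul_sum]
  refine (mul_le_mul_of_nonneg_left hgeom (by positivity)).trans (le_of_eq ?_)
  ring

/-- The sum over all labellings of `T` by scales increasing away from the root, with root label at
least `n`. -/
def treeSum (d : ℕ) (κ : ℝ) (N : ℕ) : BinTree V → ℕ → ℝ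
  | .leaf v, n => (1 / 2) ^ (n * Γ.posIndicator {v})
  | .graft A B, n => ∑ m ∈ Finset.Icc n N, Γ.growth A.support B.support m *
      (2 ^ (Γ.cross A.support B.support).card * κ / 2 ^ (d * m)) *
      (treeSum d κ N A m * treeSum d κ N B m)

theorem treeSum_nonneg (d : ℕ) {κ : ℝ} (hκ : 0 ≤ κ) (N : ℕ) (T : BinTree V) (n : ℕ) :
    0 ≤ Γ.treeSum d κ N T n := by
  induction T generalizing n with
  | leaf v => unfold treeSum; positivity
  | graft A B hA hB =>
    exact Finset.sum_nonneg fun m _ => mul_nonneg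
      (mul_nonneg (Γ.growth_nonneg _ _ m) (by positivity)) (mul_nonneg (hA m) (hB m))

theorem ofReal_treeSum_graft (d : ℕ) {κ : ℝ} (hκ : 0 ≤ κ) (N : ℕ) (S T : BinTree V) (n : ℕ) :
    ENNReal.ofReal (Γ.treeSum d κ N (.graft S T) n) =
      ∑ m ∈ Finset.Icc n N, ENNReal.ofReal (Γ.growth S.support T.support m) *
        (ENNReal.ofReal (2 ^ (Γ.cross S.support T.support).card * κ / 2 ^ (d * m)) *
          ENNReal.ofReal (Γ.treeSum d κ N S m * Γ.treeSum d κ N T m)) := by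
  have hpos (m : ℕ) : 0 ≤ Γ.treeSum d κ N S m * Γ.treeSum d κ N T m :=
    mul_nonneg (Γ.treeSum_nonneg d hκ N S m) (Γ.treeSum_nonneg d hκ N T m)
  have hgrowth (m : ℕ) : 0 ≤ Γ.growth S.support T.support m := Γ.growth_nonneg _ _ m
  rw [treeSum, ENNReal.ofReal_sum_of_nonneg fun m _ => mul_nonneg
    (mul_nonneg (hgrowth m) (by positivity)) (hpos m)]
  refine Finset.sum_congr rfl fun m _ => ?_
  rw [mul_assoc (Γ.growth _ _ m), ENNReal.ofReal_mul (hgrowth m),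
    ENNReal.ofReal_mul (by positivity)]

variable {Γ} in
theorem NonNegative.treeSum_le [Fintype V] {d : ℕ} (h : Γ.NonNegative d) (hZ : Γ.IntegerTypes)
    {κ L : ℝ} (hκ : 0 ≤ κ) (hL : 1 ≤ L) {N : ℕ} (hN : (N : ℝ) + 1 ≤ 3 * L) {T : BinTree V}
    (hT : T.labels.Nodup) (hsub : T.support ⊆ Γ.inner) (n : ℕ) :
    Γ.treeSum d κ N T n ≤ Γ.clusterBound d κ T.support n * L ^ Γ.null d T.clusters := by
  induction T generalizing n with
  | leaf v =>
    rw [null_clusters_leaf, pow_zero, mul_one, BinTree.support_leaf]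
    exact Γ.le_clusterBound_singleton d κ v n
  | graft A B ihA ihB =>
    obtain ⟨hA, hB, hdisj⟩ := BinTree.nodup_graft.1 hT
    rw [BinTree.support_graft] at hsub ⊢
    have hsA := Finset.union_subset_left hsub
    have hsB := Finset.union_subset_right hsub
    have hterm (m : ℕ) : Γ.growth A.support B.support m *
        (2 ^ (Γ.cross A.support B.support).card * κ / 2 ^ (d * m)) *
          (Γ.treeSum d κ N A m * Γ.treeSum d κ N B m) ≤
        Γ.clusterBound d κ (A.support ∪ B.support) m *
          (L ^ (Γ.null d A.clusters + Γ.null d B.clusters) / 3) := by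
      have hgrowth : 0 ≤ Γ.growth A.support B.support m := Γ.growth_nonneg _ _ m
      have hprod := mul_le_mul (ihA hA hsA m) (ihB hB hsB m) (Γ.treeSum_nonneg d hκ N B m)
        (mul_nonneg (Γ.clusterBound_nonneg d hκ _ m) (by positivity))
      refine (mul_le_mul_of_nonneg_left hprod (by positivity)).trans ?_
      have hunion := Γ.clusterBound_union (d := d) hκ hdisj A.support_nonempty B.support_nonempty m
      have hpow : 0 ≤ L ^ (Γ.null d A.clusters + Γ.null d B.clusters) / 3 := by positivity
      refine le_trans (le_of_eq ?_) (mul_le_mul_of_nonneg_right hunion hpow)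
      ring
    rw [treeSum, Γ.null_clusters_graft d hdisj, pow_add L]
    refine (Finset.sum_le_sum fun m _ => hterm m).trans ?_
    rw [← Finset.sum_mul]
    refine (mul_le_mul_of_nonneg_right (h.sum_clusterBound_le hZ hκ hL hN
      (A.support_nonempty.mono Finset.subset_union_left) hsub n) (by positivity)).trans ?_
    exact le_of_eq (by ring)

end Diagram

/-! ### Integration over relative positions -/

/-- `G` does not change when the points with labels in `B` are translated together. -/
def IsShiftInvariant {V A R : Type*} [AddZeroClass A] (B : Finset V) (G : (V → A) → R) : Prop :=
  ∀ (a : A) (x : V → A), G (x + (B : Set V).indicator fun _ => a) = G x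

section IsShiftInvariant

variable {V A R : Type*} {B : Finset V}

theorem IsShiftInvariant.mul [AddZeroClass A] [Mul R] {G H : (V → A) → R}
    (hG : IsShiftInvariant B G) (hH : IsShiftInvariant B H) :
    IsShiftInvariant B fun x => G x * H x := fun a x => by
  simp only [hG a x, hH a x]

variable [AddCommGroup A]

theorem isShiftInvariant_sub {i j : V} (h : i ∈ B ↔ j ∈ B) (g : A → R) :
    IsShiftInvariant B fun x : V → A => g (x j - x i) := fun a x => by
  have hij : (B : Set V).indicator (fun _ => a) j = (B : Set V).indicator (fun _ => a) i := by
    simp only [Set.indicator_apply, Finset.mem_coe, h]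
  simp only [Pi.add_apply, hij, add_sub_add_right_eq_sub]

variable [Fintype V] [MeasureSpace A] [MeasurableAdd₂ A] [MeasurableSub₂ A]
  [SigmaFinite (volume : Measure A)] [(volume : Measure A).IsAddLeftInvariant]

/-- Averaging over a simultaneous translation of the points in `B` decouples `x j - x i`. -/
theorem IsShiftInvariant.volume_mul_lintegral_mul_sub {i j : V} (hi : i ∉ B) (hj : j ∈ B)
    {G : (V → A) → ℝ≥0∞} (hG : Measurable G) (hinv : IsShiftInvariant B G)
    {g : A → ℝ≥0∞} (hg : Measurable g) :
    volume (Set.univ : Set A) * ∫⁻ x, G x * g (x j - x i) = (∫⁻ y, g y) * ∫⁻ x, G x := by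
  have hshift (a : A) : ∫⁻ x, G x * g (x j - x i) = ∫⁻ x, G x * g (a + (x j - x i)) := by
    rw [← lintegral_add_right_eq_self _ ((B : Set V).indicator fun _ => a)]
    refine lintegral_congr fun x => ?_
    rw [hinv, Pi.add_apply, Pi.add_apply, Set.indicator_of_mem (Finset.mem_coe.2 hj),
      Set.indicator_of_notMem (Finset.mem_coe.not.2 hi), add_zero, add_sub_right_comm, add_comm a]
  have hmeas : Measurable (Function.uncurry
      fun (a : A) (x : V → A) => G x * g (a + (x j - x i))) := by
    fun_prop
  calc volume (Set.univ : Set A) * ∫⁻ x, G x * g (x j - x i)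
      = ∫⁻ _ : A, ∫⁻ x : V → A, G x * g (x j - x i) := by rw [lintegral_const, mul_comm]
    _ = ∫⁻ a : A, ∫⁻ x : V → A, G x * g (a + (x j - x i)) := lintegral_congr hshift
    _ = ∫⁻ x : V → A, ∫⁻ a : A, G x * g (a + (x j - x i)) :=
        lintegral_lintegral_swap hmeas.aemeasurable
    _ = ∫⁻ x : V → A, G x * ∫⁻ y, g y := by
        refine lintegral_congr fun x => ?_
        rw [lintegral_const_mul _ (by fun_prop), lintegral_add_right_eq_self g]
    _ = (∫⁻ y, g y) * ∫⁻ x, G x := by rw [lintegral_mul_const _ hG, mul_comm]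

end IsShiftInvariant

section Torus

variable {d : ℕ}

theorem one_le_volume_torus : 1 ≤ volume (Set.univ : Set (Torus d)) := by
  rw [volume_pi, Measure.pi_univ]
  refine Finset.one_le_prod' fun _ _ => ?_
  rw [AddCircle.measure_univ, ENNReal.one_le_ofReal]
  linarith [Real.pi_gt_three]

theorem IsShiftInvariant.lintegral_mul_sub_le {V : Type*} [Fintype V] {B : Finset V} {i j : V}
    (hij : i ∈ B ↔ j ∉ B) {G : (V → Torus d) → ℝ≥0∞} (hG : Measurable G)
    (hinv : IsShiftInvariant B G) {g : Torus d → ℝ≥0∞} (hg : Measurable g)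
    (heven : ∀ y, g (-y) = g y) :
    ∫⁻ x, G x * g (x j - x i) ≤ (∫⁻ y, g y) * ∫⁻ x, G x := by
  refine (le_mul_of_one_le_left' (one_le_volume_torus (d := d))).trans (le_of_eq ?_)
  by_cases hi : i ∈ B
  · rw [← hinv.volume_mul_lintegral_mul_sub (hij.1 hi) hi hG hg]
    have hflip (x : V → Torus d) : g (x j - x i) = g (x i - x j) := by rw [← heven, neg_sub]
    simp only [hflip]
  · exact hinv.volume_mul_lintegral_mul_sub hi (not_not.1 (hij.not.1 hi)) hG hg

/-- The indicator function of the ball of radius `π 2⁻ᵐ` for the maximum norm, marking the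
differences of scale at least `m`. -/
def ballInd (m : ℕ) : Torus d → ℝ≥0∞ :=
  (Metric.closedBall 0 (Real.pi / 2 ^ m)).indicator 1

@[fun_prop]
theorem measurable_ballInd (m : ℕ) : Measurable (ballInd (d := d) m) :=
  measurable_one.indicator Metric.isClosed_closedBall.measurableSet

theorem ballInd_eq_one {m : ℕ} {y : Torus d} (h : ‖y‖ ≤ Real.pi / 2 ^ m) : ballInd m y = 1 := by
  rw [ballInd, Set.indicator_of_mem (mem_closedBall_zero_iff.2 h), Pi.one_apply]

theorem ballInd_neg (m : ℕ) (y : Torus d) : ballInd m (-y) = ballInd m y := by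
  simp only [ballInd, Set.indicator_apply, mem_closedBall_zero_iff, norm_neg, Pi.one_apply]

theorem lintegral_ballInd_le (m : ℕ) :
    ∫⁻ y : Torus d, ballInd m y ≤ ENNReal.ofReal ((2 * Real.pi) ^ d / 2 ^ (d * m)) := by
  rw [ballInd, lintegral_indicator_one Metric.isClosed_closedBall.measurableSet, volume_pi,
    Measure.pi_closedBall _ _ (by positivity)]
  calc ∏ i : Fin d, volume (Metric.closedBall ((0 : Torus d) i) (Real.pi / 2 ^ m))
      ≤ ∏ _i : Fin d, ENNReal.ofReal (2 * (Real.pi / 2 ^ m)) := by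
        refine Finset.prod_le_prod' fun i _ => ?_
        rw [AddCircle.volume_closedBall]
        exact ENNReal.ofReal_le_ofReal (min_le_right _ _)
    _ = ENNReal.ofReal ((2 * Real.pi) ^ d / 2 ^ (d * m)) := by
        rw [Finset.prod_const, Finset.card_univ, Fintype.card_fin,
          ← ENNReal.ofReal_pow (by positivity), ← mul_div_assoc, div_pow, ← pow_mul, mul_comm m d]

end Torus

namespace Diagram

variable {𝔗 : Set ℝ} {V E : Type*} (Γ : Diagram 𝔗 V E) {d : ℕ}

/-- The position of the end point of an edge relative to its starting point, `x_{e₊} - x_{e₋}`. -/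
def edgeDiff (x : V → Torus d) (e : E) : Torus d := x (Γ.tgt e) - x (Γ.src e)

@[fun_prop]
theorem measurable_edgeDiff (e : E) :
    Measurable fun x : V → Torus d => Γ.edgeDiff x e := by
  unfold edgeDiff
  fun_prop

variable [Fintype E]

/-- An upper bound for the indicator that some edge between `U` and `W` has scale at least `m`, or
that `m = 0`. -/
def link (U W : Finset V) (m : ℕ) (x : V → Torus d) : ℝ≥0∞ :=
  (if m = 0 then 1 else 0) + ∑ e ∈ Γ.cross U W, ballInd m (Γ.edgeDiff x e)

/-- The majorant of the integrand contributed by the tree `T`: the sum over all labellings of `T` by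
scales increasing away from the root, with root label at least `n`. -/
def majorant (N : ℕ) : BinTree V → ℕ → (V → Torus d) → ℝ≥0∞
  | .leaf v, n, _ => ENNReal.ofReal ((1 / 2) ^ (n * Γ.posIndicator {v}))
  | .graft A B, n, x => ∑ m ∈ Finset.Icc n N,
      ENNReal.ofReal (Γ.growth A.support B.support m) * Γ.link A.support B.support m x *
        (majorant N A m x * majorant N B m x)

theorem link_comm (U W : Finset V) (m : ℕ) (x : V → Torus d) :
    Γ.link U W m x = Γ.link W U m x := by
  rw [link, link, cross_comm]

@[fun_prop]
theorem measurable_link (U W : Finset V) (m : ℕ) : Measurable (Γ.link (d := d) U W m) := by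
  unfold link
  fun_prop

@[fun_prop]
theorem measurable_majorant (N : ℕ) (T : BinTree V) (n : ℕ) :
    Measurable (Γ.majorant (d := d) N T n) := by
  induction T generalizing n with
  | leaf v => exact measurable_const
  | graft A B hA hB =>
    change Measurable fun x => Γ.majorant N (.graft A B) n x
    simp only [majorant]
    fun_prop

theorem majorant_congr (N : ℕ) {T T' : BinTree V} (h : T.SwapEquiv T') (n : ℕ)
    (x : V → Torus d) : Γ.majorant N T n x = Γ.majorant N T' n x := by
  induction h generalizing n with
  | leaf v => rfl
  | congr h1 h2 ih1 ih2 => simp only [majorant, ih1, ih2, h1.support_eq, h2.support_eq]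
  | swap h1 h2 ih1 ih2 =>
    simp only [majorant, ih1, ih2, h1.support_eq, h2.support_eq]
    refine Finset.sum_congr rfl fun m _ => ?_
    rw [growth_comm, link_comm, mul_comm (Γ.majorant N _ m x)]

theorem isShiftInvariant_majorant (N : ℕ) {T : BinTree V} {B : Finset V}
    (h : T.support ⊆ B ∨ Disjoint T.support B) (n : ℕ) :
    IsShiftInvariant B (Γ.majorant (d := d) N T n) := by
  induction T generalizing n with
  | leaf v => exact fun a x => rfl
  | graft S T hS hT =>
    rw [BinTree.support_graft, Finset.union_subset_iff, Finset.disjoint_union_left] at h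
    have hlink (m : ℕ) : IsShiftInvariant B (Γ.link (d := d) S.support T.support m) := by
      have hends : ∀ e ∈ Γ.cross S.support T.support, (Γ.src e ∈ B ↔ Γ.tgt e ∈ B) := by
        intro e he
        rw [mem_cross] at he
        rcases h with ⟨hSB, hTB⟩ | ⟨hSB, hTB⟩ <;> grind [Finset.disjoint_left]
      intro a x
      exact congrArg (_ + ·) <| Finset.sum_congr rfl fun e he =>
        isShiftInvariant_sub (hends e he) (ballInd m) a x
    intro a x
    have hS' := fun m => hS (h.imp And.left And.left) m a x
    have hT' := fun m => hT (h.imp And.right And.right) m a x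
    simp only [majorant, hS', hT', hlink _ a x]

variable [Fintype V]

theorem lintegral_mul_link_le {U W : Finset V} (hdisj : Disjoint U W) (m : ℕ)
    {G : (V → Torus d) → ℝ≥0∞} (hG : Measurable G) (hinv : IsShiftInvariant U G) :
    ∫⁻ x, G x * Γ.link U W m x ≤
      ENNReal.ofReal (2 ^ (Γ.cross U W).card * (2 * Real.pi) ^ d / 2 ^ (d * m)) * ∫⁻ x, G x := by
  set κ : ℝ := (2 * Real.pi) ^ d / 2 ^ (d * m) with hκ
  set c := (Γ.cross U W).card
  have hedge : ∀ e ∈ Γ.cross U W, ∫⁻ x, G x * ballInd m (Γ.edgeDiff x e) ≤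
      ENNReal.ofReal κ * ∫⁻ x, G x := by
    intro e he
    have hiff : Γ.src e ∈ U ↔ Γ.tgt e ∉ U := by
      have hU : ∀ v ∈ U, v ∉ W := fun v hv => Finset.disjoint_left.1 hdisj hv
      have := Γ.mem_cross.1 he
      grind
    refine (hinv.lintegral_mul_sub_le hiff hG (measurable_ballInd m) (ballInd_neg m)).trans ?_
    gcongr
    exact lintegral_ballInd_le m
  have hroot : (if m = 0 then 1 else 0 : ℝ≥0∞) ≤ ENNReal.ofReal κ := by
    split_ifs with hm
    · rw [ENNReal.one_le_ofReal, hκ, hm, mul_zero, pow_zero, div_one]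
      exact one_le_pow₀ (by linarith [Real.pi_gt_three])
    · exact zero_le
  have hcard : (1 : ℝ≥0∞) + c ≤ 2 ^ c := by
    rw [add_comm]
    exact_mod_cast Nat.lt_two_pow_self
  calc ∫⁻ x, G x * Γ.link U W m x
      = (if m = 0 then 1 else 0) * (∫⁻ x, G x) +
          ∑ e ∈ Γ.cross U W, ∫⁻ x, G x * ballInd m (Γ.edgeDiff x e) := by
        simp only [link, mul_add, Finset.mul_sum]
        rw [lintegral_add_left (by fun_prop), lintegral_mul_const _ hG,
          lintegral_finsetSum _ (by fun_prop), mul_comm]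
    _ ≤ ENNReal.ofReal κ * (∫⁻ x, G x) + ∑ _e ∈ Γ.cross U W, ENNReal.ofReal κ * ∫⁻ x, G x := by
        gcongr with e he
        exact hedge e he
    _ = (1 + c) * ENNReal.ofReal κ * ∫⁻ x, G x := by
        rw [Finset.sum_const, nsmul_eq_mul]
        ring
    _ ≤ 2 ^ c * ENNReal.ofReal κ * ∫⁻ x, G x := by gcongr
    _ = _ := by
        rw [mul_div_assoc, ENNReal.ofReal_mul (by positivity), ENNReal.ofReal_pow (by norm_num),
          ENNReal.ofReal_ofNat]

theorem lintegral_mul_majorant_graft (N : ℕ) (S T : BinTree V) (n : ℕ)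
    {H : (V → Torus d) → ℝ≥0∞} (hH : Measurable H) :
    ∫⁻ x, H x * Γ.majorant N (.graft S T) n x =
      ∑ m ∈ Finset.Icc n N, ENNReal.ofReal (Γ.growth S.support T.support m) *
        ∫⁻ x, H x * Γ.majorant N T m x * Γ.majorant N S m x *
          Γ.link S.support T.support m x := by
  simp only [majorant, Finset.mul_sum]
  rw [lintegral_finsetSum _ (by fun_prop)]
  refine Finset.sum_congr rfl fun m _ => ?_
  rw [← lintegral_const_mul _ (by fun_prop)]
  exact lintegral_congr fun x => by ring

theorem lintegral_mul_majorant_le (N : ℕ) {T : BinTree V} (hT : T.labels.Nodup) (n : ℕ)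
    {H : (V → Torus d) → ℝ≥0∞} (hH : Measurable H)
    (hinv : ∀ B ⊆ T.support, IsShiftInvariant B H) :
    ∫⁻ x, H x * Γ.majorant N T n x ≤
      ENNReal.ofReal (Γ.treeSum d ((2 * Real.pi) ^ d) N T n) * ∫⁻ x, H x := by
  set κ : ℝ := (2 * Real.pi) ^ d
  have hκ0 : 0 ≤ κ := by positivity
  induction T generalizing n H with
  | leaf v =>
    simp only [majorant, treeSum]
    rw [lintegral_mul_const _ hH, mul_comm]
  | graft S T ihS ihT =>
    obtain ⟨hS, hT, hdisj⟩ := BinTree.nodup_graft.1 hT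
    rw [BinTree.support_graft] at hinv
    have hinvS : ∀ B ⊆ S.support, IsShiftInvariant B H := fun B hB =>
      hinv B (hB.trans Finset.subset_union_left)
    have hinvT : ∀ B ⊆ T.support, IsShiftInvariant B H := fun B hB =>
      hinv B (hB.trans Finset.subset_union_right)
    have hbranches (m : ℕ) : ∫⁻ x, H x * Γ.majorant N T m x * Γ.majorant N S m x ≤
        ENNReal.ofReal (Γ.treeSum d κ N S m * Γ.treeSum d κ N T m) * ∫⁻ x, H x := by
      rw [ENNReal.ofReal_mul (Γ.treeSum_nonneg d hκ0 N S m), mul_assoc]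
      refine (ihS hS m (by fun_prop) fun B hB => (hinvS B hB).mul <|
        Γ.isShiftInvariant_majorant N (.inr (hdisj.symm.mono_right hB)) m).trans ?_
      gcongr
      exact ihT hT m hH hinvT
    have hlink (m : ℕ) := Γ.lintegral_mul_link_le hdisj m
      (G := fun x => H x * Γ.majorant N T m x * Γ.majorant N S m x) (by fun_prop)
      (((hinvS _ subset_rfl).mul (Γ.isShiftInvariant_majorant N (.inr hdisj.symm) m)).mul
        (Γ.isShiftInvariant_majorant N (.inl subset_rfl) m))
    rw [Γ.lintegral_mul_majorant_graft N S T n hH]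
    calc _ ≤ ∑ m ∈ Finset.Icc n N, ENNReal.ofReal (Γ.growth S.support T.support m) *
            (ENNReal.ofReal (2 ^ (Γ.cross S.support T.support).card * κ / 2 ^ (d * m)) *
              (ENNReal.ofReal (Γ.treeSum d κ N S m * Γ.treeSum d κ N T m) * ∫⁻ x, H x)) := by
          gcongr with m
          refine (hlink m).trans ?_
          gcongr
          exact hbranches m
      _ = ENNReal.ofReal (Γ.treeSum d κ N (.graft S T) n) * ∫⁻ x, H x := by
          simp only [Γ.ofReal_treeSum_graft d hκ0, Finset.sum_mul, mul_assoc]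

end Diagram

/-! ### Scales and the pointwise bound -/

section Scale

variable {d : ℕ}

theorem norm_le_pi (y : Torus d) : ‖y‖ ≤ Real.pi := by
  refine (pi_norm_le_iff_of_nonneg Real.pi_pos.le).2 fun i => ?_
  refine (AddCircle.norm_le_half_period (2 * Real.pi) Real.two_pi_pos.ne').trans_eq ?_
  rw [abs_of_pos Real.two_pi_pos]
  ring

/-- The dyadic scale of `y`, truncated at `N`: the largest `s ≤ N` such that `y` lies in the ball of
radius `π 2⁻ˢ` for the maximum norm. -/
def scale (N : ℕ) (y : Torus d) : ℕ := Nat.findGreatest (fun s => ‖y‖ ≤ Real.pi / 2 ^ s) N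

theorem scale_le (N : ℕ) (y : Torus d) : scale N y ≤ N := Nat.findGreatest_le _

theorem norm_le_scale (N : ℕ) (y : Torus d) : ‖y‖ ≤ Real.pi / 2 ^ scale N y :=
  Nat.findGreatest_spec (P := fun s => ‖y‖ ≤ Real.pi / 2 ^ s) N.zero_le
    (by simpa using norm_le_pi y)

theorem inv_two_pow_scale_le {N : ℕ} {ε : ℝ} (hε : 1 / 2 ^ (N + 1) ≤ ε) (y : Torus d) :
    1 / 2 ^ (scale N y + 1) ≤ ‖y‖ + ε := by
  rcases (scale_le N y).eq_or_lt with h | h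
  · rw [h]
    linarith [norm_nonneg y]
  · have hlt : Real.pi / 2 ^ (scale N y + 1) < ‖y‖ :=
      not_le.1 <| Nat.findGreatest_is_greatest (P := fun s => ‖y‖ ≤ Real.pi / 2 ^ s)
        (Nat.lt_succ_self (scale N y)) h
    have hone : (1 : ℝ) / 2 ^ (scale N y + 1) ≤ Real.pi / 2 ^ (scale N y + 1) := by
      gcongr
      linarith [Real.pi_gt_three]
    have hε0 : (0 : ℝ) ≤ ε := le_trans (by positivity) hε
    linarith

theorem exists_scale_cutoff {ε : ℝ} (hε : ε ∈ Set.Ioo (0 : ℝ) 1) :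
    ∃ N : ℕ, ε ≤ 1 / 2 ^ N ∧ 1 / 2 ^ (N + 1) ≤ ε ∧
      (N : ℝ) + 1 ≤ 3 * max 1 (Real.log (1 / ε)) := by
  have hε0 := hε.1
  obtain ⟨N, hN, hN'⟩ := exists_nat_pow_near (one_le_one_div hε0 hε.2.le) (one_lt_two (α := ℝ))
  refine ⟨N, (le_one_div (by positivity) hε0).1 hN,
    ((one_div_lt hε0 (by positivity)).1 hN').le, ?_⟩
  have hlog : N * Real.log 2 ≤ Real.log (1 / ε) := by
    rw [← Real.log_pow]
    exact Real.log_le_log (by positivity) hN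
  nlinarith [N.cast_nonneg (α := ℝ), Real.log_two_gt_d9, le_max_left 1 (Real.log (1 / ε)),
    le_max_right 1 (Real.log (1 / ε))]

/-- The smallness of a kernel of positive type `t`, up to a constant: only the first power of the
distance is kept. -/
def posFactor (ε t : ℝ) (y : Torus d) : ℝ := if 0 < t then min 1 (‖y‖ + ε) else 1

theorem posFactor_nonneg {ε : ℝ} (hε : 0 ≤ ε) (t : ℝ) (y : Torus d) : 0 ≤ posFactor ε t y := by
  unfold posFactor
  split_ifs <;> positivity

theorem posFactor_le_one (ε t : ℝ) (y : Torus d) : posFactor ε t y ≤ 1 := by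
  unfold posFactor
  split_ifs
  exacts [min_le_left _ _, le_rfl]

theorem posFactor_le (ε : ℝ) {t : ℝ} (ht : 0 < t) (y : Torus d) :
    posFactor ε t y ≤ ‖y‖ + ε := by
  rw [posFactor, if_pos ht]
  exact min_le_right _ _

theorem prod_posFactor_le {ι : Type*} {s : Finset ι} {ε : ℝ} (hε : 0 ≤ ε) {t : ι → ℝ}
    (y : ι → Torus d) {i : ι} (hi : i ∈ s) (ht : 0 < t i) :
    ∏ j ∈ s, posFactor ε (t j) (y j) ≤ ‖y i‖ + ε := by
  rw [← Finset.mul_prod_erase s _ hi]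
  exact (mul_le_of_le_one_right (posFactor_nonneg hε _ _) <| Finset.prod_le_one
    (fun _ _ => posFactor_nonneg hε _ _) fun _ _ => posFactor_le_one ε _ _).trans
      (posFactor_le ε ht _)

end Scale

theorem dist_le_of_link {V X : Type*} [PseudoMetricSpace X] {x : V → X} {U W : Finset V}
    {a b r : ℝ} (hU : ∀ i ∈ U, ∀ j ∈ U, dist (x i) (x j) ≤ a)
    (hW : ∀ i ∈ W, ∀ j ∈ W, dist (x i) (x j) ≤ b) {u w : V} (hu : u ∈ U) (hw : w ∈ W)
    (hr : dist (x u) (x w) ≤ r) {i j : V} (hi : i ∈ U ∪ W) (hj : j ∈ U ∪ W) :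
    dist (x i) (x j) ≤ a + r + b := by
  have ha : 0 ≤ a := dist_nonneg.trans (hU u hu u hu)
  have hb : 0 ≤ b := dist_nonneg.trans (hW w hw w hw)
  have hr0 : 0 ≤ r := dist_nonneg.trans hr
  have hacross : ∀ i ∈ U, ∀ j ∈ W, dist (x i) (x j) ≤ a + r + b := fun i hi j hj =>
    (dist_triangle4 _ (x u) (x w) _).trans <|
      add_le_add (add_le_add (hU i hi u hu) hr) (hW w hw j hj)
  rcases Finset.mem_union.1 hi with hi | hi <;> rcases Finset.mem_union.1 hj with hj | hj
  · linarith [hU i hi j hj]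
  · exact hacross i hi j hj
  · rw [dist_comm]
    exact hacross j hj i hi
  · linarith [hW i hi j hj]

namespace Diagram

variable {𝔗 : Set ℝ} {V E : Type*} (Γ : Diagram 𝔗 V E) {d : ℕ}

/-- The dyadic bound, up to a constant, for the kernel at an edge. -/
def edgeBound (N : ℕ) (ε : ℝ) (x : V → Torus d) (e : E) : ℝ :=
  2 ^ (scale N (Γ.edgeDiff x e) * Γ.singOrder e) * posFactor ε (Γ.type e) (Γ.edgeDiff x e)

theorem edgeBound_nonneg (N : ℕ) {ε : ℝ} (hε : 0 ≤ ε) (x : V → Torus d) (e : E) :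
    0 ≤ Γ.edgeBound N ε x e :=
  mul_nonneg (by positivity) (posFactor_nonneg hε _ _)

variable {Γ} [Fintype E] {N : ℕ} {x : V → Torus d}

theorem Linked.dist_le {T : BinTree V} (hT : T.labels.Nodup) {n : ℕ}
    (h : Γ.Linked (fun e => scale N (Γ.edgeDiff x e)) N T n) :
    ∀ i ∈ T.support, ∀ j ∈ T.support,
      dist (x i) (x j) ≤ (T.support.card - 1) * (Real.pi / 2 ^ n) := by
  induction T generalizing n with
  | leaf v => simp [BinTree.support_leaf]
  | graft A B ihA ihB =>
    obtain ⟨hA, hB, hdisj⟩ := BinTree.nodup_graft.1 hT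
    obtain ⟨m, hnm, -, hlA, hlB, -, hm⟩ := h
    have hA1 : (1 : ℝ) ≤ A.support.card := by exact_mod_cast A.support_nonempty.card_pos
    have hB1 : (1 : ℝ) ≤ B.support.card := by exact_mod_cast B.support_nonempty.card_pos
    obtain ⟨a, ha, b, hb, hab⟩ : ∃ a ∈ A.support, ∃ b ∈ B.support,
        dist (x a) (x b) ≤ Real.pi / 2 ^ m := by
      rcases hm with rfl | ⟨e, he, hs⟩
      · obtain ⟨a, ha⟩ := A.support_nonempty
        obtain ⟨b, hb⟩ := B.support_nonempty
        exact ⟨a, ha, b, hb, by simpa [dist_eq_norm] using norm_le_pi (x a - x b)⟩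
      · have hdiff : dist (x (Γ.tgt e)) (x (Γ.src e)) ≤ Real.pi / 2 ^ m := by
          rw [← hs, dist_eq_norm]
          exact norm_le_scale N _
        rcases Γ.mem_cross.1 he with ⟨hsrc, htgt⟩ | ⟨hsrc, htgt⟩
        · exact ⟨_, hsrc, _, htgt, by rwa [dist_comm]⟩
        · exact ⟨_, htgt, _, hsrc, hdiff⟩
    intro i hi j hj
    rw [BinTree.support_graft] at hi hj ⊢
    rw [Finset.card_union_of_disjoint hdisj, Nat.cast_add]
    calc dist (x i) (x j)
        ≤ (A.support.card - 1) * (Real.pi / 2 ^ m) + Real.pi / 2 ^ m +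
            (B.support.card - 1) * (Real.pi / 2 ^ m) :=
          dist_le_of_link (ihA hA hlA) (ihB hB hlB) ha hb hab hi hj
      _ = (A.support.card + B.support.card - 1) * (Real.pi / 2 ^ m) := by ring
      _ ≤ (A.support.card + B.support.card - 1) * (Real.pi / 2 ^ n) := by
          gcongr
          · linarith
          · norm_num

theorem prod_posFactor_cross_le {ε : ℝ} (hε : 0 ≤ ε) {U W : Finset V} {m : ℕ}
    (hεm : ε ≤ 1 / 2 ^ m) (hdiam : ∀ i ∈ U ∪ W, ∀ j ∈ U ∪ W,
      dist (x i) (x j) ≤ (U.card + W.card - 1) * (Real.pi / 2 ^ m)) :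
    ∏ e ∈ Γ.cross U W, posFactor ε (Γ.type e) (Γ.edgeDiff x e) ≤
      (4 * (U.card + W.card) / 2 ^ m) ^ Γ.newPos U W := by
  rcases Γ.newPos_eq_zero_or U W with h0 | ⟨h1, hU, hW, hUW⟩
  · rw [h0, pow_zero]
    exact Finset.prod_le_one (fun _ _ => posFactor_nonneg hε _ _) fun _ _ => posFactor_le_one ε _ _
  · obtain ⟨e, he, ht⟩ := posIndicator_eq_one_iff.1 hUW
    have heU : e ∉ Γ.edgesIn U := fun h => (type_nonpos_of_posIndicator_eq_zero hU h).not_gt ht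
    have heW : e ∉ Γ.edgesIn W := fun h => (type_nonpos_of_posIndicator_eq_zero hW h).not_gt ht
    rw [mem_edgesIn] at he heU heW
    have hcross : e ∈ Γ.cross U W := by grind [mem_cross]
    have hcard : (1 : ℝ) ≤ U.card + W.card := by
      rw [← Nat.cast_add, ← Finset.card_union_add_card_inter]
      exact_mod_cast Nat.le_add_right_of_le (Finset.card_pos.2 ⟨_, he.1⟩)
    rw [h1, pow_one]
    calc ∏ e ∈ Γ.cross U W, posFactor ε (Γ.type e) (Γ.edgeDiff x e)
        ≤ ‖Γ.edgeDiff x e‖ + ε := prod_posFactor_le hε _ hcross ht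
      _ ≤ (U.card + W.card - 1) * (Real.pi / 2 ^ m) + 1 / 2 ^ m := by
          rw [edgeDiff, ← dist_eq_norm]
          exact add_le_add (hdiam _ he.2 _ he.1) hεm
      _ ≤ (U.card + W.card - 1) * (4 / 2 ^ m) + 4 / 2 ^ m := by
          gcongr
          · exact Real.pi_le_four
          · norm_num
      _ = 4 * (U.card + W.card) / 2 ^ m := by ring

theorem prod_edgeBound_cross_le {ε : ℝ} (hε : 0 ≤ ε) {U W : Finset V} {m : ℕ}
    (hεm : ε ≤ 1 / 2 ^ m) (hscale : ∀ e ∈ Γ.cross U W, scale N (Γ.edgeDiff x e) ≤ m)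
    (hdiam : ∀ i ∈ U ∪ W, ∀ j ∈ U ∪ W,
      dist (x i) (x j) ≤ (U.card + W.card - 1) * (Real.pi / 2 ^ m)) :
    ∏ e ∈ Γ.cross U W, Γ.edgeBound N ε x e ≤ Γ.growth U W m := by
  simp only [edgeBound]
  rw [Finset.prod_mul_distrib, growth, Finset.mul_sum, ← Finset.prod_pow_eq_pow_sum]
  refine mul_le_mul ?_ (prod_posFactor_cross_le hε hεm hdiam)
    (Finset.prod_nonneg fun _ _ => posFactor_nonneg hε _ _) (by positivity)
  gcongr with e he
  · exact one_le_two
  · exact hscale e he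

theorem one_le_link {U W : Finset V} {m : ℕ}
    (hm : m = 0 ∨ ∃ e ∈ Γ.cross U W, scale N (Γ.edgeDiff x e) = m) : 1 ≤ Γ.link U W m x := by
  rcases hm with hm | ⟨e, he, rfl⟩
  · rw [link, if_pos hm]
    exact le_self_add
  · refine le_add_left ?_
    rw [← ballInd_eq_one (norm_le_scale N (Γ.edgeDiff x e))]
    exact Finset.single_le_sum
      (f := fun e' => ballInd (scale N (Γ.edgeDiff x e)) (Γ.edgeDiff x e'))
      (fun _ _ => zero_le) he

variable [Fintype V]

theorem NonNegative.prod_edgeBound_singleton_le (hΓ : Γ.NonNegative d) (hZ : Γ.IntegerTypes)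
    {ε : ℝ} (hε : 0 ≤ ε) {n : ℕ} (hεn : ε ≤ 1 / 2 ^ n) {v : V} (hv : v ∈ Γ.inner) :
    ∏ e ∈ Γ.edgesIn {v}, Γ.edgeBound N ε x e ≤ (1 / 2) ^ (n * Γ.posIndicator {v}) := by
  have hsing : ∀ e ∈ Γ.edgesIn {v}, Γ.singOrder e = 0 := by
    have hsum := hΓ.sum_singOrder_le hZ (Finset.singleton_nonempty v)
      (Finset.singleton_subset_iff.2 hv)
    rw [Finset.card_singleton, Nat.cast_one, sub_self, mul_zero] at hsum
    exact Finset.sum_eq_zero_iff.1 (by exact_mod_cast hsum.antisymm (by positivity))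
  have hbound : ∏ e ∈ Γ.edgesIn {v}, Γ.edgeBound N ε x e =
      ∏ e ∈ Γ.edgesIn {v}, posFactor ε (Γ.type e) (Γ.edgeDiff x e) :=
    Finset.prod_congr rfl fun e he => by rw [edgeBound, hsing e he, mul_zero, pow_zero, one_mul]
  rw [hbound]
  rcases Γ.posIndicator_eq_zero_or_one {v} with h0 | h1
  · rw [h0, mul_zero, pow_zero]
    exact Finset.prod_le_one (fun _ _ => posFactor_nonneg hε _ _) fun _ _ => posFactor_le_one ε _ _
  · obtain ⟨e, he, ht⟩ := posIndicator_eq_one_iff.1 h1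
    have hloop : Γ.edgeDiff x e = 0 := by
      rw [mem_edgesIn, Finset.mem_singleton, Finset.mem_singleton] at he
      rw [edgeDiff, he.1, he.2, sub_self]
    rw [h1, mul_one, one_div_pow]
    refine (prod_posFactor_le hε _ he ht).trans ?_
    rwa [hloop, norm_zero, zero_add]

theorem Linked.prod_edgeBound_le_majorant (hΓ : Γ.NonNegative d) (hZ : Γ.IntegerTypes) {ε : ℝ}
    (hε : 0 ≤ ε) (hεN : ε ≤ 1 / 2 ^ N) {T : BinTree V} (hT : T.labels.Nodup)
    (hsub : T.support ⊆ Γ.inner) {n : ℕ}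
    (h : Γ.Linked (fun e => scale N (Γ.edgeDiff x e)) N T n) :
    ENNReal.ofReal (∏ e ∈ Γ.edgesIn T.support, Γ.edgeBound N ε x e) ≤ Γ.majorant N T n x := by
  have hle : ∀ m ≤ N, ε ≤ 1 / 2 ^ m := fun m hm => hεN.trans (by gcongr; exact one_le_two)
  induction T generalizing n with
  | leaf v =>
    rw [BinTree.support_leaf] at hsub ⊢
    exact ENNReal.ofReal_le_ofReal <| hΓ.prod_edgeBound_singleton_le hZ hε (hle n h)
      (Finset.singleton_subset_iff.1 hsub)
  | graft A B ihA ihB =>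
    obtain ⟨m, hnm, hmN, hlA, hlB, hscale, hm⟩ := h
    have hdiam := Linked.dist_le hT ⟨m, le_rfl, hmN, hlA, hlB, hscale, hm⟩
    obtain ⟨hA, hB, hdisj⟩ := BinTree.nodup_graft.1 hT
    rw [BinTree.support_graft] at hsub hdiam ⊢
    rw [Finset.card_union_of_disjoint hdisj, Nat.cast_add] at hdiam
    have hprod (S : Finset E) : 0 ≤ ∏ e ∈ S, Γ.edgeBound N ε x e :=
      Finset.prod_nonneg fun e _ => Γ.edgeBound_nonneg N hε x e
    rw [Γ.prod_edgesIn_union hdisj, ENNReal.ofReal_mul (hprod _), ENNReal.ofReal_mul (hprod _),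
      majorant]
    refine le_trans ?_ (Finset.single_le_sum (fun _ _ => zero_le) (Finset.mem_Icc.2 ⟨hnm, hmN⟩))
    have hcross := ENNReal.ofReal_le_ofReal
      (prod_edgeBound_cross_le hε (hle m hmN) hscale hdiam)
    exact mul_le_mul' (hcross.trans (le_mul_of_one_le_right' (one_le_link hm))) <| mul_le_mul'
      (ihA hA (Finset.union_subset_left hsub) hlA) (ihB hB (Finset.union_subset_right hsub) hlB)

end Diagram

/-! ### Kernels -/

section Kernel

variable {d : ℕ}

/-- A symmetric majorant, uniformly integrable in `N`, of the kernels of type at least `-d + δ`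
truncated at scale `N`. -/
def dyadicKernel (δ : ℝ) (N : ℕ) (y : Torus d) : ℝ≥0∞ :=
  ∑ s ∈ Finset.range (N + 1), ENNReal.ofReal (((2 : ℝ) ^ ((d : ℝ) - δ)) ^ s) * ballInd s y

@[fun_prop]
theorem measurable_dyadicKernel (δ : ℝ) (N : ℕ) : Measurable (dyadicKernel (d := d) δ N) := by
  unfold dyadicKernel
  fun_prop

theorem dyadicKernel_neg (δ : ℝ) (N : ℕ) (y : Torus d) :
    dyadicKernel δ N (-y) = dyadicKernel δ N y := by
  simp only [dyadicKernel, ballInd_neg]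

theorem le_dyadicKernel (δ : ℝ) {s N : ℕ} (hs : s ≤ N) {y : Torus d}
    (hy : ‖y‖ ≤ Real.pi / 2 ^ s) :
    ENNReal.ofReal (((2 : ℝ) ^ ((d : ℝ) - δ)) ^ s) ≤ dyadicKernel δ N y := by
  refine le_trans (le_of_eq ?_) (Finset.single_le_sum (fun _ _ => zero_le)
    (Finset.mem_range_succ_iff.2 hs))
  rw [ballInd_eq_one hy, mul_one]

/-- An upper bound for the integrals of the majorants `dyadicKernel δ N`. -/
def dyadicMass (d : ℕ) (δ : ℝ) : ℝ := (2 * Real.pi) ^ d * (1 - (2 : ℝ) ^ (-δ))⁻¹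

theorem one_le_two_pi_pow (d : ℕ) : 1 ≤ (2 * Real.pi) ^ d :=
  one_le_pow₀ (by linarith [Real.pi_gt_three])

theorem one_le_dyadicMass (d : ℕ) {δ : ℝ} (hδ : 0 < δ) : 1 ≤ dyadicMass d δ := by
  have hr0 : (0 : ℝ) < (2 : ℝ) ^ (-δ) := by positivity
  have hr1 : (2 : ℝ) ^ (-δ) < 1 := Real.rpow_lt_one_of_one_lt_of_neg one_lt_two (by linarith)
  exact one_le_mul_of_one_le_of_one_le (one_le_two_pi_pow d)
    ((one_le_inv₀ (by linarith)).2 (by linarith))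

theorem lintegral_dyadicKernel_le {δ : ℝ} (hδ : 0 < δ) (N : ℕ) :
    ∫⁻ y : Torus d, dyadicKernel δ N y ≤ ENNReal.ofReal (dyadicMass d δ) := by
  have hr0 : (0 : ℝ) ≤ (2 : ℝ) ^ (-δ) := by positivity
  have hr1 : (2 : ℝ) ^ (-δ) < 1 := Real.rpow_lt_one_of_one_lt_of_neg one_lt_two (by linarith)
  have hrate (s : ℕ) : ((2 : ℝ) ^ ((d : ℝ) - δ)) ^ s * ((2 * Real.pi) ^ d / 2 ^ (d * s)) =
      (2 * Real.pi) ^ d * ((2 : ℝ) ^ (-δ)) ^ s := by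
    rw [sub_eq_add_neg, Real.rpow_add two_pos, Real.rpow_natCast, mul_pow, ← pow_mul]
    field_simp
  calc ∫⁻ y : Torus d, dyadicKernel δ N y
      = ∑ s ∈ Finset.range (N + 1), ENNReal.ofReal (((2 : ℝ) ^ ((d : ℝ) - δ)) ^ s) *
          ∫⁻ y : Torus d, ballInd s y := by
        simp only [dyadicKernel]
        rw [lintegral_finsetSum _ (by fun_prop)]
        exact Finset.sum_congr rfl fun s _ => lintegral_const_mul _ (measurable_ballInd s)
    _ ≤ ∑ s ∈ Finset.range (N + 1),
          ENNReal.ofReal ((2 * Real.pi) ^ d * ((2 : ℝ) ^ (-δ)) ^ s) := by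
        refine Finset.sum_le_sum fun s _ => ?_
        rw [← hrate, ENNReal.ofReal_mul (by positivity)]
        gcongr
        exact lintegral_ballInd_le s
    _ = ENNReal.ofReal ((2 * Real.pi) ^ d * ∑ s ∈ Finset.range (N + 1), ((2 : ℝ) ^ (-δ)) ^ s) := by
        rw [Finset.mul_sum, ENNReal.ofReal_sum_of_nonneg fun s _ => by positivity]
    _ ≤ ENNReal.ofReal (dyadicMass d δ) := by
        rw [dyadicMass, ← tsum_geometric_of_lt_one hr0 hr1]
        gcongr
        exact (summable_geometric_of_lt_one hr0 hr1).sum_le_tsum _ fun _ _ => by positivity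

theorem torusNorm_nonneg (y : Torus d) : 0 ≤ torusNorm y := Real.sqrt_nonneg _

theorem norm_le_torusNorm (y : Torus d) : ‖y‖ ≤ torusNorm y :=
  (pi_norm_le_iff_of_nonneg (torusNorm_nonneg y)).2 fun i => Real.le_sqrt_of_sq_le <|
    Finset.single_le_sum (f := fun i => ‖y i‖ ^ 2) (fun _ _ => sq_nonneg _) (Finset.mem_univ i)

theorem torusNorm_le (y : Torus d) : torusNorm y ≤ d * ‖y‖ := by
  refine Real.sqrt_le_iff.2 ⟨by positivity, ?_⟩
  calc ∑ i, ‖y i‖ ^ 2 ≤ ∑ _i : Fin d, ‖y‖ ^ 2 := by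
        gcongr with i
        exact norm_le_pi_norm y i
    _ = d * ‖y‖ ^ 2 := by simp
    _ ≤ d ^ 2 * ‖y‖ ^ 2 := by
        gcongr
        exact_mod_cast Nat.le_self_pow two_ne_zero d
    _ = (d * ‖y‖) ^ 2 := by rw [mul_pow]

theorem torusNorm_add_le {ε : ℝ} (hε : ε ∈ Set.Ioo (0 : ℝ) 1) (y : Torus d) :
    torusNorm y + ε ≤ 4 * (d + 1) * min 1 (‖y‖ + ε) := by
  have hnorm := torusNorm_le y
  have hd : (0 : ℝ) ≤ d := d.cast_nonneg
  have hdy : 0 ≤ d * ‖y‖ := by positivity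
  have hdε : 0 ≤ d * ε := mul_nonneg hd hε.1.le
  rw [mul_min_of_nonneg _ _ (by positivity)]
  refine le_min ?_ (by linarith [norm_nonneg y, hε.1])
  have : d * ‖y‖ ≤ d * 4 := by
    gcongr
    exact (norm_le_pi y).trans Real.pi_le_four
  linarith [hε.2]

theorem rpow_torusNorm_le_of_nonneg {ε t M : ℝ} (hε : ε ∈ Set.Ioo (0 : ℝ) 1) (ht : 0 ≤ t)
    (htM : t ≤ M) (y : Torus d) :
    (torusNorm y + ε) ^ t ≤ (4 * (d + 1) : ℝ) ^ M * min 1 (‖y‖ + ε) ^ t := by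
  have hε0 := hε.1
  have hmin : 0 ≤ min 1 (‖y‖ + ε) := by positivity
  calc (torusNorm y + ε) ^ t ≤ (4 * (d + 1) * min 1 (‖y‖ + ε)) ^ t :=
        Real.rpow_le_rpow (add_nonneg (torusNorm_nonneg y) hε0.le) (torusNorm_add_le hε y) ht
    _ = (4 * (d + 1) : ℝ) ^ t * min 1 (‖y‖ + ε) ^ t := Real.mul_rpow (by positivity) hmin
    _ ≤ (4 * (d + 1) : ℝ) ^ M * min 1 (‖y‖ + ε) ^ t := by
        gcongr
        linarith [d.cast_nonneg (α := ℝ)]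

theorem rpow_torusNorm_le_of_nonpos {ε t : ℝ} {N : ℕ} (hεN : 1 / 2 ^ (N + 1) ≤ ε)
    (htd : -(d : ℝ) ≤ t) (ht : t ≤ 0) (y : Torus d) :
    (torusNorm y + ε) ^ t ≤ 2 ^ d * ((2 : ℝ) ^ (-t)) ^ scale N y := by
  have hscale : 1 / 2 ^ (scale N y + 1) ≤ torusNorm y + ε :=
    (inv_two_pow_scale_le hεN y).trans (by gcongr; exact norm_le_torusNorm y)
  calc (torusNorm y + ε) ^ t ≤ ((1 : ℝ) / 2 ^ (scale N y + 1)) ^ t :=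
        Real.rpow_le_rpow_of_nonpos (by positivity) hscale ht
    _ = (2 : ℝ) ^ (-t) * ((2 : ℝ) ^ (-t)) ^ scale N y := by
        rw [one_div, Real.inv_rpow (by positivity), ← Real.rpow_neg (by positivity),
          Real.rpow_pow_comm two_pos.le, pow_succ', Real.mul_rpow two_pos.le (by positivity)]
    _ ≤ 2 ^ d * ((2 : ℝ) ^ (-t)) ^ scale N y := by
        gcongr
        rw [← Real.rpow_natCast]
        exact Real.rpow_le_rpow_of_exponent_le one_le_two (by linarith)

/-- The constant in the dyadic bounds for kernels of type between `-d` and `M`. -/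
def kernelConst (d : ℕ) (M : ℝ) : ℝ := 2 ^ d + (4 * (d + 1) : ℝ) ^ M

theorem one_le_kernelConst (d : ℕ) (M : ℝ) : 1 ≤ kernelConst d M :=
  le_add_of_le_of_nonneg (one_le_pow₀ one_le_two) (by positivity)

theorem two_pow_le_kernelConst (d : ℕ) (M : ℝ) : 2 ^ d ≤ kernelConst d M :=
  le_add_of_nonneg_right (by positivity)

theorem rpow_le_kernelConst (d : ℕ) (M : ℝ) : (4 * (d + 1) : ℝ) ^ M ≤ kernelConst d M :=
  le_add_of_nonneg_left (by positivity)

theorem rpow_torusNorm_le_of_int {ε t M : ℝ} (hε : ε ∈ Set.Ioo (0 : ℝ) 1) {N : ℕ}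
    (hεN : 1 / 2 ^ (N + 1) ≤ ε) (htd : -(d : ℝ) ≤ t) (htM : t ≤ M) (hZ : ∃ n : ℤ, t = n)
    (y : Torus d) :
    (torusNorm y + ε) ^ t ≤
      kernelConst d M * (2 ^ (scale N y * ⌊-t⌋₊) * posFactor ε t y) := by
  have hε0 := hε.1
  have hC : 0 ≤ kernelConst d M := zero_le_one.trans (one_le_kernelConst d M)
  obtain ⟨n, rfl⟩ := hZ
  rcases le_or_gt (n : ℝ) 0 with ht | ht
  · obtain ⟨a, rfl⟩ := Int.exists_eq_neg_ofNat (by exact_mod_cast ht)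
    have hpow : ((2 : ℝ) ^ (-((-(a : ℤ) : ℤ) : ℝ))) ^ scale N y =
        2 ^ (scale N y * ⌊-((-(a : ℤ) : ℤ) : ℝ)⌋₊) := by
      simp [← pow_mul, mul_comm a]
    rw [posFactor, if_neg ht.not_gt, mul_one, ← hpow]
    refine (rpow_torusNorm_le_of_nonpos hεN htd ht y).trans ?_
    gcongr
    exact two_pow_le_kernelConst d M
  · have hn : (1 : ℝ) ≤ n := by
      exact_mod_cast Int.add_one_le_of_lt (Int.cast_pos.1 ht)
    rw [posFactor, if_pos ht, Nat.floor_eq_zero.2 (by linarith), mul_zero, pow_zero, one_mul]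
    refine (rpow_torusNorm_le_of_nonneg hε ht.le htM y).trans ?_
    gcongr
    · exact rpow_le_kernelConst d M
    · exact Real.rpow_le_self_of_le_one (by positivity) (min_le_left _ _) hn

theorem rpow_torusNorm_le_dyadicKernel {ε t M δ : ℝ} (hε : ε ∈ Set.Ioo (0 : ℝ) 1) {N : ℕ}
    (hεN : 1 / 2 ^ (N + 1) ≤ ε) (hδ : 0 < δ) (htd : -(d : ℝ) + δ ≤ t) (htM : t ≤ M)
    (y : Torus d) :
    ENNReal.ofReal ((torusNorm y + ε) ^ t) ≤
      ENNReal.ofReal (kernelConst d M) * dyadicKernel δ N y := by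
  have hε0 := hε.1
  have hC : 0 ≤ kernelConst d M := zero_le_one.trans (one_le_kernelConst d M)
  suffices h : ∃ s ≤ N, ‖y‖ ≤ Real.pi / 2 ^ s ∧
      (torusNorm y + ε) ^ t ≤ kernelConst d M * ((2 : ℝ) ^ ((d : ℝ) - δ)) ^ s by
    obtain ⟨s, hs, hy, hle⟩ := h
    refine (ENNReal.ofReal_le_ofReal hle).trans ?_
    rw [ENNReal.ofReal_mul hC]
    gcongr
    exact le_dyadicKernel δ hs hy
  rcases le_total 0 t with ht | ht
  · refine ⟨0, N.zero_le, by simpa using norm_le_pi y, ?_⟩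
    refine (rpow_torusNorm_le_of_nonneg hε ht htM y).trans ?_
    rw [pow_zero]
    gcongr
    · exact rpow_le_kernelConst d M
    · exact Real.rpow_le_one (by positivity) (min_le_left _ _) ht
  · refine ⟨scale N y, scale_le N y, norm_le_scale N y, ?_⟩
    refine (rpow_torusNorm_le_of_nonpos hεN (by linarith) ht y).trans ?_
    gcongr
    · exact two_pow_le_kernelConst d M
    · exact one_le_two
    · linarith

theorem le_mul_rpow_of_rpow_neg_mul_le {r t k B : ℝ} (hr : 0 < r) (h : r ^ (-t) * k ≤ B) :
    k ≤ B * r ^ t := by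
  rwa [Real.rpow_neg hr.le, inv_mul_le_iff₀ (by positivity), mul_comm] at h

theorem abs_le_of_rpow_torusNorm_mul_le {ε t M B k : ℝ} {N : ℕ} {y : Torus d}
    (hε : ε ∈ Set.Ioo (0 : ℝ) 1) (hεN : 1 / 2 ^ (N + 1) ≤ ε) (htd : -(d : ℝ) ≤ t) (htM : t ≤ M)
    (hZ : ∃ n : ℤ, t = n) (hB : 0 ≤ B) (h : (torusNorm y + ε) ^ (-t) * |k| ≤ B) :
    |k| ≤ B * kernelConst d M * (2 ^ (scale N y * ⌊-t⌋₊) * posFactor ε t y) := by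
  have hpos : 0 < torusNorm y + ε := add_pos_of_nonneg_of_pos (torusNorm_nonneg y) hε.1
  refine (le_mul_rpow_of_rpow_neg_mul_le hpos h).trans ?_
  rw [mul_assoc]
  exact mul_le_mul_of_nonneg_left (rpow_torusNorm_le_of_int hε hεN htd htM hZ y) hB

theorem enorm_le_of_rpow_torusNorm_mul_le {ε t M B δ k : ℝ} {N : ℕ} {y : Torus d}
    (hε : ε ∈ Set.Ioo (0 : ℝ) 1) (hεN : 1 / 2 ^ (N + 1) ≤ ε) (hδ : 0 < δ)
    (htd : -(d : ℝ) + δ ≤ t) (htM : t ≤ M) (hB : 0 ≤ B)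
    (h : (torusNorm y + ε) ^ (-t) * |k| ≤ B) :
    ‖k‖ₑ ≤ ENNReal.ofReal (B * kernelConst d M) * dyadicKernel δ N y := by
  have hpos : 0 < torusNorm y + ε := add_pos_of_nonneg_of_pos (torusNorm_nonneg y) hε.1
  rw [Real.enorm_eq_ofReal_abs, ENNReal.ofReal_mul hB, mul_assoc]
  refine (ENNReal.ofReal_le_ofReal (le_mul_rpow_of_rpow_neg_mul_le hpos h)).trans ?_
  rw [ENNReal.ofReal_mul hB]
  gcongr
  exact rpow_torusNorm_le_dyadicKernel hε hεN hδ htd htM y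

end Kernel

/-! ### Legs and test functions -/

namespace Diagram

variable {𝔗 : Set ℝ} {V E : Type*} (Γ : Diagram 𝔗 V E) {d : ℕ}

/-- The points with labels `l e` are integrated out one after the other. -/
theorem lintegral_mul_prod_edgeDiff_le [Fintype V] {W : Torus d → ℝ≥0∞} (hW : Measurable W)
    (heven : ∀ y, W (-y) = W y) {S : Finset E} {l : E → V}
    (hl : ∀ e ∈ S, Γ.src e = l e ↔ Γ.tgt e ≠ l e)
    (hother : ∀ e ∈ S, ∀ e' ∈ S, e ≠ e' → Γ.src e' ≠ l e ∧ Γ.tgt e' ≠ l e)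
    {H : (V → Torus d) → ℝ≥0∞} (hH : Measurable H)
    (hinv : ∀ e ∈ S, IsShiftInvariant {l e} H) :
    ∫⁻ x, H x * ∏ e ∈ S, W (Γ.edgeDiff x e) ≤ (∫⁻ y, W y) ^ S.card * ∫⁻ x, H x := by
  induction S using Finset.induction_on with
  | empty => simp
  | insert e S he ih =>
    simp only [Finset.forall_mem_insert] at hl hother hinv
    have hprod : IsShiftInvariant {l e} fun x => ∏ e' ∈ S, W (Γ.edgeDiff x e') := fun a x =>
      Finset.prod_congr rfl fun e' he' => by
        have hends := hother.1.2 e' he' (ne_of_mem_of_not_mem he' he).symm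
        refine isShiftInvariant_sub ?_ W a x
        simp only [Finset.mem_singleton, hends.1, hends.2]
    calc ∫⁻ x, H x * ∏ e' ∈ insert e S, W (Γ.edgeDiff x e')
        = ∫⁻ x, H x * (∏ e' ∈ S, W (Γ.edgeDiff x e')) * W (Γ.edgeDiff x e) := by
          refine lintegral_congr fun x => ?_
          rw [Finset.prod_insert he]
          ring
      _ ≤ (∫⁻ y, W y) * ∫⁻ x, H x * ∏ e' ∈ S, W (Γ.edgeDiff x e') :=
          (hinv.1.mul hprod).lintegral_mul_sub_le
            (by simpa only [Finset.mem_singleton] using hl.1) (by fun_prop) hW heven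
      _ ≤ (∫⁻ y, W y) * ((∫⁻ y, W y) ^ S.card * ∫⁻ x, H x) := by
          gcongr
          exact ih hl.2 (fun e₁ h₁ e₂ h₂ => (hother.2 e₁ h₁).2 e₂ h₂) hinv.2
      _ = (∫⁻ y, W y) ^ (insert e S).card * ∫⁻ x, H x := by
          rw [Finset.card_insert_of_notMem he, pow_succ', mul_assoc]

/-- A leaf on the leg `e`. -/
def legLeaf (e : E) : V := if Γ.src e ∈ Γ.leaves then Γ.src e else Γ.tgt e

theorem src_eq_legLeaf_or (e : E) : Γ.src e = Γ.legLeaf e ∨ Γ.tgt e = Γ.legLeaf e := by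
  unfold legLeaf
  split_ifs
  exacts [.inl rfl, .inr rfl]

variable {Γ} in
theorem HasLegs.incidence_unique [Fintype E] {k : ℕ} (h : Γ.HasLegs k) {v : V} (hv : v ∈ Γ.leaves)
    {a b : E ⊕ E} (ha : Sum.elim Γ.src Γ.tgt a = v) (hb : Sum.elim Γ.src Γ.tgt b = v) : a = b := by
  have hcard : (Finset.univ.filter fun c => Sum.elim Γ.src Γ.tgt c = v).card = 1 := by
    rw [← h.2 v hv, vertexDegree, ← Finset.card_disjSum]
    congr 1
    ext (e | e) <;> simp
  exact Finset.card_le_one.1 hcard.le a (by simpa using ha) b (by simpa using hb)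

variable [Fintype V]

theorem mem_inner {v : V} : v ∈ Γ.inner ↔ v ∉ Γ.leaves := by simp [inner]

variable [Fintype E]

theorem legLeaf_mem {e : E} (he : e ∈ Γ.legs) : Γ.legLeaf e ∈ Γ.leaves := by
  have hends : Γ.src e ∉ Γ.leaves → Γ.tgt e ∈ Γ.leaves := by
    simpa [legs, mem_innerEdges, mem_inner] using he
  unfold legLeaf
  split_ifs with h
  exacts [h, hends h]

namespace HasLegs

variable {Γ} {k : ℕ} (h : Γ.HasLegs k)
include h

theorem card_eq : Fintype.card V = Γ.inner.card + 2 * k := by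
  have hinner : Γ.inner = Γ.leavesᶜ := by
    ext v
    rw [mem_inner, Finset.mem_compl]
  rw [← h.1, hinner, Finset.card_compl_add_card]

theorem src_eq_legLeaf_iff {e : E} (he : e ∈ Γ.legs) :
    Γ.src e = Γ.legLeaf e ↔ Γ.tgt e ≠ Γ.legLeaf e := by
  refine ⟨fun hs ht => ?_, (Γ.src_eq_legLeaf_or e).resolve_right⟩
  exact Sum.inl_ne_inr (h.incidence_unique (Γ.legLeaf_mem he) (a := .inl e) (b := .inr e) hs ht)

theorem eq_of_legLeaf {e e' : E} (he : e ∈ Γ.legs)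
    (he' : Γ.src e' = Γ.legLeaf e ∨ Γ.tgt e' = Γ.legLeaf e) : e = e' := by
  have hincident {f : E} (hf : Γ.src f = Γ.legLeaf e ∨ Γ.tgt f = Γ.legLeaf e) :
      ∃ a : E ⊕ E, Sum.elim Γ.src Γ.tgt a = Γ.legLeaf e ∧ Sum.elim id id a = f :=
    hf.elim (⟨.inl f, ·, rfl⟩) (⟨.inr f, ·, rfl⟩)
  obtain ⟨a, ha, rfl⟩ := hincident he'
  obtain ⟨b, hb, hbe⟩ := hincident (Γ.src_eq_legLeaf_or e)
  rw [← hbe, h.incidence_unique (Γ.legLeaf_mem he) hb ha]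

theorem card_legs_le : Γ.legs.card ≤ 2 * k := by
  rw [← h.1]
  refine Finset.card_le_card_of_injOn Γ.legLeaf (fun e he => Γ.legLeaf_mem he) ?_
  exact fun e he e' _ heq => h.eq_of_legLeaf he (heq ▸ Γ.src_eq_legLeaf_or e')

end HasLegs

end Diagram

theorem IsSmooth.continuous {d : ℕ} {I : Type*} [Fintype I] {φ : (I → Torus d) → ℝ}
    (h : IsSmooth φ) : Continuous φ := by
  have hmk : IsOpenQuotientMap
      (Pi.map fun _ : I => Pi.map fun _ : Fin d => ((↑) : ℝ → AddCircle (2 * Real.pi))) :=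
    .piMap fun _ => .piMap fun _ => QuotientAddGroup.isOpenQuotientMap_mk
  exact hmk.continuous_comp_iff.1 (ContDiff.continuous h)

theorem IsSmooth.bddAbove_range_abs {d : ℕ} {I : Type*} [Fintype I] {φ : (I → Torus d) → ℝ}
    (h : IsSmooth φ) : BddAbove (Set.range fun x => |φ x|) :=
  (isCompact_range h.continuous.abs).bddAbove

namespace Diagram

variable {𝔗 : Set ℝ} {V E : Type*} (Γ : Diagram 𝔗 V E)

theorem lintegral_glue [Fintype V] {X : Type*} [MeasureSpace X] [SigmaFinite (volume : Measure X)]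
    {F : (V → X) → ℝ≥0∞} (hF : Measurable F) :
    ∫⁻ xL, ∫⁻ xI, F (Γ.glue xL xI) = ∫⁻ x, F x := by
  have hmp := (volume_preserving_piEquivPiSubtypeProd (fun _ : V => X) (· ∈ Γ.leaves)).symm
  rw [← hmp.lintegral_comp hF, Measure.volume_eq_prod]
  refine Eq.trans ?_ (lintegral_prod _ (hF.comp (MeasurableEquiv.measurable _)).aemeasurable).symm
  rw [Subsingleton.elim (Finset.Subtype.fintype Γ.leaves) (Subtype.fintype (· ∈ Γ.leaves))]
  rfl

variable {d : ℕ} {K : 𝔗 → ℝ → Torus d → ℝ} {ε : ℝ}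

@[fun_prop]
theorem measurable_weight (hK : ∀ t, Measurable (K t ε)) (S : Finset E) :
    Measurable (Γ.weight K ε S) := by
  unfold weight
  exact Finset.measurable_prod _ fun e _ => (hK _).comp (by fun_prop)

theorem enorm_weight (S : Finset E) (x : V → Torus d) :
    ‖Γ.weight K ε S x‖ₑ = ∏ e ∈ S, ‖K (Γ.type e) ε (Γ.edgeDiff x e)‖ₑ := by
  simp only [weight, edgeDiff, Real.enorm_eq_ofReal_abs, Finset.abs_prod]
  exact ENNReal.ofReal_prod_of_nonneg fun _ _ => abs_nonneg _

variable [Fintype V] [Fintype E]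

variable {Γ} in
theorem abs_valTest_le (hK : ∀ t, Measurable (K t ε))
    {φ : ({v // v ∈ Γ.leaves} → Torus d) → ℝ} (hφ : BddAbove (Set.range fun x => |φ x|))
    {R : ℝ} (hR : 0 ≤ R)
    (h : ∫⁻ x, ‖Γ.weight K ε Γ.innerEdges x * Γ.weight K ε Γ.legs x‖ₑ ≤ ENNReal.ofReal R) :
    |Γ.valTest K ε φ| ≤ supNorm φ * R := by
  have hsup : 0 ≤ supNorm φ := Real.iSup_nonneg fun x => abs_nonneg _
  set F : (V → Torus d) → ℝ := fun x => Γ.weight K ε Γ.innerEdges x * Γ.weight K ε Γ.legs x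
  have hF : Measurable F := (Γ.measurable_weight hK _).mul (Γ.measurable_weight hK _)
  rw [← ENNReal.ofReal_le_ofReal_iff (by positivity), ← Real.enorm_eq_ofReal_abs]
  calc ‖Γ.valTest K ε φ‖ₑ
      ≤ ∫⁻ xL, ‖Γ.val K ε xL * φ xL‖ₑ := enorm_integral_le_lintegral_enorm _
    _ ≤ ∫⁻ xL, ENNReal.ofReal (supNorm φ) * ∫⁻ xI, ‖F (Γ.glue xL xI)‖ₑ := by
        refine lintegral_mono fun xL => ?_
        rw [enorm_mul, mul_comm, Real.enorm_eq_ofReal_abs (φ xL)]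
        gcongr
        · exact le_ciSup hφ xL
        · exact enorm_integral_le_lintegral_enorm _
    _ = ENNReal.ofReal (supNorm φ) * ∫⁻ x, ‖F x‖ₑ := by
        rw [lintegral_const_mul' _ _ ENNReal.ofReal_ne_top, Γ.lintegral_glue hF.enorm]
    _ ≤ ENNReal.ofReal (supNorm φ * R) := by
        rw [ENNReal.ofReal_mul hsup]
        gcongr

/-! ### The bound at a fixed cutoff -/

theorem HasLegs.lintegral_weight_mul_le {Γ : Diagram 𝔗 V E} {k : ℕ} (hk : Γ.HasLegs k)
    (hK : ∀ t, Measurable (K t ε)) {W : Torus d → ℝ≥0∞} (hW : Measurable W)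
    (heven : ∀ y, W (-y) = W y) (hKW : ∀ t y, ‖K t ε y‖ₑ ≤ W y) :
    ∫⁻ x, ‖Γ.weight K ε Γ.innerEdges x * Γ.weight K ε Γ.legs x‖ₑ ≤
      (∫⁻ y, W y) ^ Γ.legs.card * ∫⁻ x, ‖Γ.weight K ε Γ.innerEdges x‖ₑ := by
  calc ∫⁻ x, ‖Γ.weight K ε Γ.innerEdges x * Γ.weight K ε Γ.legs x‖ₑ
      ≤ ∫⁻ x, ‖Γ.weight K ε Γ.innerEdges x‖ₑ * ∏ e ∈ Γ.legs, W (Γ.edgeDiff x e) := by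
        refine lintegral_mono fun x => ?_
        rw [enorm_mul, Γ.enorm_weight Γ.legs]
        gcongr
        exact hKW _ _
    _ ≤ (∫⁻ y, W y) ^ Γ.legs.card * ∫⁻ x, ‖Γ.weight K ε Γ.innerEdges x‖ₑ := by
        refine Γ.lintegral_mul_prod_edgeDiff_le hW heven
          (fun e he => hk.src_eq_legLeaf_iff he)
          (fun e he e' _ hne => not_or.1 fun he' => hne (hk.eq_of_legLeaf he he'))
          (Γ.measurable_weight hK _).enorm fun e he a x => congrArg _ ?_
        refine Finset.prod_congr rfl fun e' he' => ?_
        have hinner {v : V} (hv : v ∈ Γ.inner) : v ∉ ({Γ.legLeaf e} : Finset V) := fun hmem =>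
          Γ.mem_inner.1 hv (Finset.mem_singleton.1 hmem ▸ Γ.legLeaf_mem he)
        have hends := Γ.mem_innerEdges.1 he'
        exact isShiftInvariant_sub (iff_of_false (hinner hends.1) (hinner hends.2)) _ a x

end Diagram

theorem clusters_mem_heppTrees {V : Type*} {X : Finset V} {T : BinTree V}
    (h : T.labels = X.val) : T.clusters ∈ heppTrees X := by
  refine Finset.mem_filter.2 ⟨Finset.mem_powerset.2 fun u hu => Finset.mem_powerset.2 ?_, T, h, rfl⟩
  exact BinTree.support_eq_of_labels_eq h ▸ BinTree.subset_support_of_mem_clusters hu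

theorem exists_tree_of_mem_heppTrees {V : Type*} {X : Finset V} (hX : X.Nonempty) :
    ∃ tree : Finset (Finset V) → BinTree V,
      ∀ F ∈ heppTrees X, (tree F).labels = X.val ∧ (tree F).clusters = F := by
  have : Nonempty (BinTree V) := ⟨.leaf hX.choose⟩
  choose! tree htree using fun F (hF : F ∈ heppTrees X) => (Finset.mem_filter.1 hF).2
  exact ⟨tree, htree⟩

theorem volume_univ_config {d : ℕ} {V : Type*} [Fintype V] :
    volume (Set.univ : Set (V → Torus d)) =
      ENNReal.ofReal (((2 * Real.pi) ^ d) ^ Fintype.card V) := by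
  simp only [volume_pi, Measure.pi_univ, AddCircle.measure_univ, Finset.prod_const,
    Finset.card_univ, Fintype.card_fin]
  rw [ENNReal.ofReal_pow (by positivity), ENNReal.ofReal_pow (by positivity)]

theorem Diagram.clusterBound_inner_le {𝔗 : Set ℝ} {V E : Type*} [Fintype V] [Fintype E]
    (Γ : Diagram 𝔗 V E) (d : ℕ) {κ : ℝ} (hκ : 1 ≤ κ) :
    Γ.clusterBound d κ Γ.inner 0 ≤ (24 * κ) ^ Γ.inner.card * 2 ^ Γ.innerEdges.card := by
  calc Γ.clusterBound d κ Γ.inner 0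
      = Γ.posConst Γ.inner * (3 * κ) ^ (Γ.inner.card - 1) * 2 ^ Γ.innerEdges.card := by
        simp [clusterBound, edgesIn_inner]
    _ ≤ 8 ^ Γ.inner.card * (3 * κ) ^ Γ.inner.card * 2 ^ Γ.innerEdges.card := by
        gcongr
        · exact Γ.posConst_le _
        · linarith
        · exact Nat.sub_le _ _
    _ = (24 * κ) ^ Γ.inner.card * 2 ^ Γ.innerEdges.card := by
        rw [← mul_pow]
        ring_nf

namespace Diagram.NonNegative

variable {𝔗 : Set ℝ} {V E : Type*} [Fintype V] [Fintype E] {Γ : Diagram 𝔗 V E} {d : ℕ}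
  (hΓ : Γ.NonNegative d) (hZ : Γ.IntegerTypes)
include hΓ hZ

theorem prod_edgeBound_le_sum_majorant (hne : Γ.inner.Nonempty) {ε : ℝ} (hε : 0 ≤ ε) {N : ℕ}
    (hεN : ε ≤ 1 / 2 ^ N) {tree : Finset (Finset V) → BinTree V}
    (htree : ∀ F ∈ heppTrees Γ.inner, (tree F).labels = Γ.inner.val ∧ (tree F).clusters = F)
    (x : V → Torus d) :
    ENNReal.ofReal (∏ e ∈ Γ.innerEdges, Γ.edgeBound N ε x e) ≤
      ∑ F ∈ heppTrees Γ.inner, Γ.majorant N (tree F) 0 x := by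
  obtain ⟨T, hT, hlinked⟩ :=
    exists_linked (Γ := Γ) (s := fun e => scale N (Γ.edgeDiff x e)) (fun e => scale_le N _) hne
  have hmem := clusters_mem_heppTrees hT
  obtain ⟨htreeT, hclusters⟩ := htree _ hmem
  have hsupp := BinTree.support_eq_of_labels_eq hT
  have hswap : T.SwapEquiv (tree T.clusters) :=
    BinTree.swapEquiv_of_clusters_eq (hT ▸ Γ.inner.nodup) (htreeT ▸ Γ.inner.nodup)
      (hsupp.trans (BinTree.support_eq_of_labels_eq htreeT).symm) hclusters.symm
  calc ENNReal.ofReal (∏ e ∈ Γ.innerEdges, Γ.edgeBound N ε x e)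
      ≤ Γ.majorant N T 0 x := by
        rw [← edgesIn_inner, ← hsupp]
        exact hlinked.prod_edgeBound_le_majorant hΓ hZ hε hεN (hT ▸ Γ.inner.nodup) hsupp.le
    _ = Γ.majorant N (tree T.clusters) 0 x := Γ.majorant_congr N hswap 0 x
    _ ≤ ∑ F ∈ heppTrees Γ.inner, Γ.majorant N (tree F) 0 x :=
        Finset.single_le_sum (f := fun F => Γ.majorant N (tree F) 0 x) (fun _ _ => zero_le) hmem

theorem lintegral_majorant_le {L : ℝ} (hL : 1 ≤ L) {N : ℕ} (hN : (N : ℝ) + 1 ≤ 3 * L)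
    {T : BinTree V} (hT : T.labels = Γ.inner.val) :
    ∫⁻ x : V → Torus d, Γ.majorant N T 0 x ≤
      ENNReal.ofReal ((24 * (2 * Real.pi) ^ d) ^ Γ.inner.card * 2 ^ Γ.innerEdges.card *
        ((2 * Real.pi) ^ d) ^ Fintype.card V * L ^ Γ.null d T.clusters) := by
  have hnodup : T.labels.Nodup := hT ▸ Γ.inner.nodup
  have hsupp := BinTree.support_eq_of_labels_eq hT
  have hκ := one_le_two_pi_pow d
  set κ := (2 * Real.pi) ^ d
  have hκ0 : 0 ≤ κ := zero_le_one.trans hκ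
  have hsum := hΓ.treeSum_le hZ hκ0 hL hN hnodup hsupp.le 0
  rw [hsupp] at hsum
  have hint := Γ.lintegral_mul_majorant_le (d := d) N hnodup 0 (H := fun _ => 1)
    measurable_const fun _ _ _ _ => rfl
  simp only [one_mul, lintegral_const, volume_univ_config] at hint
  refine hint.trans ?_
  rw [← ENNReal.ofReal_mul (Γ.treeSum_nonneg d hκ0 N _ _), mul_right_comm _ (κ ^ _)]
  gcongr
  exact hsum.trans (by gcongr; exact Γ.clusterBound_inner_le d hκ)

theorem lintegral_prod_edgeBound_le (hne : Γ.inner.Nonempty) {ε L : ℝ} (hε : 0 ≤ ε) {N : ℕ}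
    (hεN : ε ≤ 1 / 2 ^ N) (hL : 1 ≤ L) (hN : (N : ℝ) + 1 ≤ 3 * L) :
    ∫⁻ x : V → Torus d, ENNReal.ofReal (∏ e ∈ Γ.innerEdges, Γ.edgeBound N ε x e) ≤
      ENNReal.ofReal ((24 * (2 * Real.pi) ^ d) ^ Γ.inner.card * 2 ^ Γ.innerEdges.card *
        ((2 * Real.pi) ^ d) ^ Fintype.card V *
          ∑ F ∈ heppTrees Γ.inner, L ^ Γ.null d F) := by
  obtain ⟨tree, htree⟩ := exists_tree_of_mem_heppTrees hne
  refine (lintegral_mono (hΓ.prod_edgeBound_le_sum_majorant hZ hne hε hεN htree)).trans ?_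
  rw [lintegral_finsetSum _ (by fun_prop), Finset.mul_sum,
    ENNReal.ofReal_sum_of_nonneg fun F _ => by positivity]
  refine Finset.sum_le_sum fun F hF => ?_
  obtain ⟨hlabels, hclusters⟩ := htree F hF
  simpa only [hclusters] using hΓ.lintegral_majorant_le hZ hL hN hlabels

theorem lintegral_weight_le {k : ℕ} (hk : Γ.HasLegs k) (hne : Γ.inner.Nonempty)
    {K : 𝔗 → ℝ → Torus d → ℝ} {A ε δ L : ℝ} (hA : 1 ≤ A) (hε : 0 ≤ ε) (hδ : 0 < δ) (hL : 1 ≤ L)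
    {N : ℕ} (hεN : ε ≤ 1 / 2 ^ N) (hN : (N : ℝ) + 1 ≤ 3 * L) (hK : ∀ t, Measurable (K t ε))
    (hinner : ∀ e ∈ Γ.innerEdges, ∀ x, |K (Γ.type e) ε (Γ.edgeDiff x e)| ≤
      A * Γ.edgeBound N ε x e)
    (hlegs : ∀ t y, ‖K t ε y‖ₑ ≤ ENNReal.ofReal A * dyadicKernel δ N y) :
    ∫⁻ x, ‖Γ.weight K ε Γ.innerEdges x * Γ.weight K ε Γ.legs x‖ₑ ≤
      ENNReal.ofReal ((24 * ((2 * Real.pi) ^ d) ^ 2) ^ Γ.inner.card *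
        (2 * A) ^ Γ.innerEdges.card * (A * dyadicMass d δ * (2 * Real.pi) ^ d) ^ (2 * k) *
          ∑ F ∈ heppTrees Γ.inner, L ^ Γ.null d F) := by
  set κ := (2 * Real.pi) ^ d
  set S := ∑ F ∈ heppTrees Γ.inner, L ^ Γ.null d F
  have hmass : 1 ≤ A * dyadicMass d δ :=
    one_le_mul_of_one_le_of_one_le hA (one_le_dyadicMass d hδ)
  have hout : (∫⁻ y : Torus d, ENNReal.ofReal A * dyadicKernel δ N y) ^ Γ.legs.card ≤
      ENNReal.ofReal ((A * dyadicMass d δ) ^ (2 * k)) := by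
    calc (∫⁻ y : Torus d, ENNReal.ofReal A * dyadicKernel δ N y) ^ Γ.legs.card
        ≤ ENNReal.ofReal (A * dyadicMass d δ) ^ Γ.legs.card := by
          rw [lintegral_const_mul _ (by fun_prop), ENNReal.ofReal_mul (by positivity)]
          gcongr
          exact lintegral_dyadicKernel_le hδ N
      _ ≤ ENNReal.ofReal ((A * dyadicMass d δ) ^ (2 * k)) := by
          rw [← ENNReal.ofReal_pow (by positivity)]
          gcongr
          exact hk.card_legs_le
  have hin : ∫⁻ x, ‖Γ.weight K ε Γ.innerEdges x‖ₑ ≤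
      ENNReal.ofReal (A ^ Γ.innerEdges.card) *
        ENNReal.ofReal ((24 * κ) ^ Γ.inner.card * 2 ^ Γ.innerEdges.card *
          κ ^ Fintype.card V * S) := by
    refine le_trans (lintegral_mono fun x => ?_) ((lintegral_const_mul' _ _
      ENNReal.ofReal_ne_top).le.trans (mul_le_mul_right
        (hΓ.lintegral_prod_edgeBound_le hZ hne hε hεN hL hN) _))
    rw [← ENNReal.ofReal_mul (by positivity), Γ.enorm_weight, ← Finset.prod_const,
      ← Finset.prod_mul_distrib, ENNReal.ofReal_prod_of_nonneg fun e _ =>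
        mul_nonneg (by positivity) (Γ.edgeBound_nonneg N hε x e)]
    refine Finset.prod_le_prod' fun e he => ?_
    rw [Real.enorm_eq_ofReal_abs]
    exact ENNReal.ofReal_le_ofReal (hinner e he x)
  refine (hk.lintegral_weight_mul_le hK (by fun_prop)
    (fun y => by rw [dyadicKernel_neg]) hlegs).trans ((mul_le_mul' hout hin).trans_eq ?_)
  rw [← ENNReal.ofReal_mul (by positivity), ← ENNReal.ofReal_mul (by positivity), hk.card_eq]
  ring_nf

end Diagram.NonNegative

theorem pow_mul_pow_mul_pow_le {a b c : ℝ} (ha : 1 ≤ a) (hb : 1 ≤ b) (hc : 1 ≤ c) (i j k : ℕ) :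
    a ^ i * b ^ j * c ^ k ≤ (a * b * c) ^ (i + j + k) := by
  rw [mul_pow, mul_pow]
  gcongr <;> first | assumption | omega

end Feynman

end

open Feynman MeasureTheory in
theorem proposition4p1_general
    (d : ℕ)
    (𝔗 : Set ℝ)
    (h𝔗_lower : ∃ δ : ℝ, 0 < δ ∧ ∀ t ∈ 𝔗, -(d : ℝ) + δ ≤ t)
    (h𝔗_upper : BddAbove 𝔗)
    (K : 𝔗 → ℝ → Torus d → ℝ)
    (hK_meas : ∀ t : 𝔗, ∀ ε ∈ Set.Ioo (0 : ℝ) 1, Measurable (K t ε))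
    (hK_bound : ∃ B : ℝ, ∀ t : 𝔗, ∀ ε ∈ Set.Ioo (0 : ℝ) 1, ∀ x : Torus d,
      (torusNorm x + ε) ^ (-(t : ℝ)) * |K t ε x| ≤ B) :
    ∃ C : ℝ, 0 < C ∧
      ∀ (V : Type*) (E : Type*) [Fintype V] [Fintype E] (Γ : Diagram 𝔗 V E) (k : ℕ),
        Γ.HasLegs k → Γ.inner.Nonempty → Γ.NonNegative d →
        (∀ e ∈ Γ.innerEdges, ∃ n : ℤ, (Γ.type e : ℝ) = n) →
        ∀ ε ∈ Set.Ioo (0 : ℝ) 1,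
          ∫⁻ x, ‖Γ.weight K ε Γ.innerEdges x * Γ.weight K ε Γ.legs x‖ₑ ≤
            ENNReal.ofReal (C ^ (Γ.inner.card + Γ.innerEdges.card + 2 * k) *
              ∑ T ∈ heppTrees Γ.inner, (max 1 (Real.log (1 / ε))) ^ Γ.null d T) := by
  obtain ⟨δ, hδ, hlower⟩ := h𝔗_lower
  obtain ⟨M, hM⟩ := h𝔗_upper
  obtain ⟨B, hB⟩ := hK_bound
  have hK_bound (t : 𝔗) {ε : ℝ} (hε : ε ∈ Set.Ioo (0 : ℝ) 1) (x : Torus d) :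
      (torusNorm x + ε) ^ (-(t : ℝ)) * |K t ε x| ≤ max B 1 :=
    (hB t ε hε x).trans (le_max_left _ _)
  have hB0 : 0 ≤ max B 1 := zero_le_one.trans (le_max_right _ _)
  set A := max B 1 * kernelConst d M
  have hA : 1 ≤ A :=
    one_le_mul_of_one_le_of_one_le (le_max_right _ _) (one_le_kernelConst d M)
  have hκ := one_le_two_pi_pow d
  have hinner : 1 ≤ 24 * ((2 * Real.pi) ^ d) ^ 2 := by nlinarith
  have hlegs : 1 ≤ A * dyadicMass d δ * (2 * Real.pi) ^ d :=
    one_le_mul_of_one_le_of_one_le (one_le_mul_of_one_le_of_one_le hA (one_le_dyadicMass d hδ)) hκ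
  refine ⟨24 * ((2 * Real.pi) ^ d) ^ 2 * (2 * A) * (A * dyadicMass d δ * (2 * Real.pi) ^ d),
    by positivity, fun V E _ _ Γ k hk hne hΓ hZ ε hε => ?_⟩
  obtain ⟨N, hεN, hNε, hN⟩ := exists_scale_cutoff hε
  refine (hΓ.lintegral_weight_le hZ hk hne hA hε.1.le hδ (le_max_left _ _) hεN hN
    (fun t => hK_meas t ε hε)
    (fun e he x => abs_le_of_rpow_torusNorm_mul_le hε hNε (by linarith [hlower _ (Γ.type e).2])
      (hM (Γ.type e).2) (hZ e he) hB0 (hK_bound _ hε _))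
    (fun t y => enorm_le_of_rpow_torusNorm_mul_le hε hNε hδ (hlower t t.2) (hM t.2) hB0
      (hK_bound t hε y))).trans ?_
  gcongr
  exact pow_mul_pow_mul_pow_le hinner (by linarith) hlegs _ _ _

theorem proposition4p1
    (d : ℕ) (hd : 1 ≤ d)
    (𝔗 : Set ℝ)
    (h𝔗_lower : ∃ δ : ℝ, 0 < δ ∧ ∀ t ∈ 𝔗, -(d : ℝ) + δ ≤ t)
    (h𝔗_upper : BddAbove 𝔗)
    (K : 𝔗 → ℝ → Feynman.Torus d → ℝ)
    (hK_meas : ∀ t : 𝔗, ∀ ε ∈ Set.Ioo (0 : ℝ) 1, Measurable (K t ε))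
    (hK_bound : ∃ B : ℝ, ∀ t : 𝔗, ∀ ε ∈ Set.Ioo (0 : ℝ) 1, ∀ x : Feynman.Torus d,
      (Feynman.torusNorm x + ε) ^ (-(t : ℝ)) * |K t ε x| ≤ B) :
    ∃ C : ℝ, 0 < C ∧
      ∀ (V E : Type) [Fintype V] [Fintype E] (Γ : Feynman.Diagram 𝔗 V E) (k : ℕ),
        Γ.HasLegs k → Γ.inner.Nonempty → Γ.NonNegative d →
        (∀ e ∈ Γ.innerEdges, ∃ n : ℤ, (Γ.type e : ℝ) = n) →
        ∀ ε ∈ Set.Ioo (0 : ℝ) 1, ∀ φ : ({v // v ∈ Γ.leaves} → Feynman.Torus d) → ℝ,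
          Feynman.IsSmooth φ →
          |Γ.valTest K ε φ| ≤
            Feynman.supNorm φ * C ^ (Γ.inner.card + Γ.innerEdges.card + 2 * k) *
              ∑ T ∈ Feynman.heppTrees Γ.inner,
                (max 1 (Real.log (1 / ε))) ^ Γ.null d T := by
  obtain ⟨C, hC, hbound⟩ := proposition4p1_general d 𝔗 h𝔗_lower h𝔗_upper K hK_meas hK_bound
  refine ⟨C, hC, fun V E _ _ Γ k hk hne hΓ hZ ε hε φ hφ => ?_⟩
  rw [mul_assoc]
  exact Feynman.Diagram.abs_valTest_le (hK_meas · ε hε) hφ.bddAbove_range_abs (by positivity)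
    (hbound V E Γ k hk hne hΓ hZ ε hε)
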